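/- All graphs are finite and simple. For a tree $T$ and a symmetric function $\varphi$ of two positive integers, let $$Z_\varphi(T)=\sum_{M}\ \prod_{uv\in M}\varphi(\deg u,\deg v),$$ where $M$ runs over all matchings of $T$ (sets of pairwise disjoint edges, including the empty set). For real $c>0$ put $$\varphi_1(i,j)=c^{\,i+j},\qquad \varphi_2(i,j)=c^{\,ij},\qquad \varphi_3(i,j)=(i+j)^c,\qquad \varphi_4(i,j)=(ij)^c .$$ We use the following trees. * $P_n$ is the path on $n$ vertices. * For odd $n$, the odd spider $\mathrm{Sp}_n$ is obtained from the star with $\frac{n-1}{2}$ leaves by subdividing every edge once. * For $a,b\ge 1$, the double broom $\mathrm{DB}_{a,b}$ consists of two adjacent vertices, with $a$ leaves attached to one and $b$ leaves attached to the other; that is, it is the tree of diameter $3$ whose two non-leaves have degrees $a+1$ and $b+1$. The balanced double broom on $m\ge 4$ vertices is $\mathrm{DB}_{\lfloor m/2\rfloor-1,\lceil m/2\rceil-1}$. * For even $n\ge 6$, the balanced wide spider $W_n$ is obtained from the balanced double broom on $\frac n2+1$ vertices by subdividing every pendant edge once; it has $n$ vertices. **Theorem.** For every $n\ge 1$ there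 is a constant $C=C(n)$ such that for all real $c\ge C$, among all trees of order $n$ the unique (up to isomorphism) tree maximizing * $Z_{\varphi_1}$ is $W_n$ if $n\ge 12$ is even, and $\mathrm{Sp}_n$ if $n\ge 7$ is odd; * $Z_{\varphi_2}$ is $\mathrm{DB}_{\lfloor n/2\rfloor-1,\lceil n/2\rceil-1}$ if $n\ge 6$; * $Z_{\varphi_3}$ is $P_n$; * $Z_{\varphi_4}$ is $P_n$. -/

import Mathlib

universe u v

namespace WeightedHosoya

/-! ## Matchings and the weighted Hosoya index -/

/-- The matchings of `G`: finite sets of edges, no two of which share a vertex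
(the empty set included). -/
def matchings {V : Type u} (G : SimpleGraph V) : Set (Finset (Sym2 V)) :=
  {M | (∀ e ∈ M, e ∈ G.edgeSet) ∧
    ∀ e ∈ M, ∀ f ∈ M, e ≠ f → ∀ x : V, ¬(x ∈ e ∧ x ∈ f)}

/-- The weighted Hosoya index: the sum over all matchings `M` of the product of the weights of the
edges in `M`. Since `V` is finite, there are finitely many matchings and the sum `∑ᶠ` is an
ordinary finite sum. -/
noncomputable def weightedHosoya {V : Type u} [Finite V] (G : SimpleGraph V) (ω : Sym2 V → ℝ) : ℝ :=
  ∑ᶠ M ∈ matchings G, ∏ e ∈ M, ω e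

/-- The degree of a vertex, as a number that depends on no decidability instances. -/
noncomputable def deg {V : Type u} (G : SimpleGraph V) (x : V) : ℕ :=
  (G.neighborSet x).ncard

/-- Symmetric functions of two degrees. -/
abbrev SymmFun : Type := {φ : ℕ → ℕ → ℝ // ∀ i j, φ i j = φ j i}

/-- The vertex-degree-based weight: the edge `xy` gets the weight `φ (deg x) (deg y)`. -/
noncomputable def degreeWeight {V : Type u} (G : SimpleGraph V) (φ : SymmFun) : Sym2 V → ℝ :=
  Sym2.lift ⟨fun x y => φ.1 (deg G x) (deg G y), fun _ _ => φ.2 _ _⟩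

/-- The index `Z_φ(G)`. -/
noncomputable def Z {V : Type u} [Finite V] (φ : SymmFun) (G : SimpleGraph V) : ℝ :=
  weightedHosoya G (degreeWeight G φ)

/-- `φ₁(i, j) = c ^ (i + j)`. -/
noncomputable def phi1 (c : ℝ) : SymmFun :=
  ⟨fun i j => c ^ (i + j), fun i j => congrArg (fun k : ℕ => c ^ k) (Nat.add_comm i j)⟩

/-- `φ₂(i, j) = c ^ (i j)`. -/
noncomputable def phi2 (c : ℝ) : SymmFun :=
  ⟨fun i j => c ^ (i * j), fun i j => congrArg (fun k : ℕ => c ^ k) (Nat.mul_comm i j)⟩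

/-- `φ₃(i, j) = (i + j) ^ c`, with a real exponent. -/
noncomputable def phi3 (c : ℝ) : SymmFun :=
  ⟨fun i j => ((i : ℝ) + (j : ℝ)) ^ c, fun i j => congrArg (fun x : ℝ => x ^ c) (add_comm (i : ℝ) (j : ℝ))⟩

/-- `φ₄(i, j) = (i j) ^ c`, with a real exponent. -/
noncomputable def phi4 (c : ℝ) : SymmFun :=
  ⟨fun i j => ((i : ℝ) * (j : ℝ)) ^ c, fun i j => congrArg (fun x : ℝ => x ^ c) (mul_comm (i : ℝ) (j : ℝ))⟩

/-! ## The extremal trees -/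

/-- Subdivide (once) every edge in the set `S` of edges of `G`: the old vertices are `inl x`, and
the new vertex on the edge `e ∈ S` is `inr e`, joined to the two ends of `e`. Edges of `G` outside
`S` are kept. -/
def subdivide {V : Type u} (G : SimpleGraph V) (S : Set (Sym2 V)) : SimpleGraph (V ⊕ ↥S) where
  Adj
    | .inl x, .inl y => G.Adj x y ∧ s(x, y) ∉ S
    | .inl x, .inr e => x ∈ e.1
    | .inr e, .inl x => x ∈ e.1
    | .inr _, .inr _ => False
  symm := ⟨by
    rintro (x | e) (y | f) h
    · exact ⟨h.1.symm, by rw [Sym2.eq_swap]; exact h.2⟩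
    · exact h
    · exact h
    · exact h⟩
  loopless := ⟨by
    rintro (x | e) h
    · exact G.loopless.irrefl x h.1
    · exact h⟩

/-- The pendant edges: those with an end of degree `1`. -/
def pendantEdges {V : Type u} (G : SimpleGraph V) : Set (Sym2 V) :=
  {e | e ∈ G.edgeSet ∧ ∃ x ∈ e, deg G x = 1}

/-- The odd spider of order `n`, for `n` odd: the `1`-subdivision of the star with `n / 2` leaves,
i.e. `n / 2` legs of length two at a common vertex. -/
def oddSpider (n : ℕ) :
    SimpleGraph (Fin (n / 2 + 1) ⊕ ↥(SimpleGraph.starGraph (0 : Fin (n / 2 + 1))).edgeSet) :=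
  subdivide (SimpleGraph.starGraph (0 : Fin (n / 2 + 1)))
    (SimpleGraph.starGraph (0 : Fin (n / 2 + 1))).edgeSet

/-- The double broom `DB_{a,b}`: two adjacent vertices `inl false` and `inl true`, with `a` leaves
attached to the first and `b` leaves attached to the second. For `a, b ≥ 1` it is the tree of
diameter three whose non-leaves have degrees `a + 1` and `b + 1`. -/
def doubleBroom (a b : ℕ) : SimpleGraph (Bool ⊕ (Fin a ⊕ Fin b)) :=
  SimpleGraph.fromRel fun
    | .inl false, .inl true => True
    | .inl false, .inr (.inl _) => True
    | .inl true, .inr (.inr _) => True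
    | _, _ => False

/-- The balanced double broom on `m ≥ 4` vertices: the non-leaves have degrees `⌊m/2⌋` and
`⌈m/2⌉`. -/
def balancedDoubleBroom (m : ℕ) :
    SimpleGraph (Bool ⊕ (Fin (m / 2 - 1) ⊕ Fin ((m + 1) / 2 - 1))) :=
  doubleBroom (m / 2 - 1) ((m + 1) / 2 - 1)

/-- The balanced wide spider `W_n`, for `n` even: subdivide every pendant edge of the balanced
double broom on `n / 2 + 1` vertices. -/
def balancedWideSpider (n : ℕ) :
    SimpleGraph ((Bool ⊕ (Fin ((n / 2 + 1) / 2 - 1) ⊕ Fin ((n / 2 + 1 + 1) / 2 - 1))) ⊕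
      ↥(pendantEdges (balancedDoubleBroom (n / 2 + 1)))) :=
  subdivide (balancedDoubleBroom (n / 2 + 1)) (pendantEdges (balancedDoubleBroom (n / 2 + 1)))

/-! ## Unique maximizers -/

/-- `G` is, up to isomorphism, the unique maximizer of `Z_φ` over the trees of order `n`: it is
such a tree, no such tree has a larger index, and any such tree with the same index is isomorphic
to `G`. -/
def IsUniqueMaximizer {V : Type v} [Finite V] (φ : SymmFun) (n : ℕ) (G : SimpleGraph V) : Prop :=
  G.IsTree ∧ Nat.card V = n ∧
    ∀ (U : Type u) [Finite U] (T : SimpleGraph U), T.IsTree → Nat.card U = n →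
      Z φ T ≤ Z φ G ∧ (Z φ T = Z φ G → Nonempty (T ≃g G))

end WeightedHosoya

/-! # Trees maximizing weighted Hosoya indices -/

namespace WeightedHosoya

open scoped Classical
open Finset

/-! ## Trees -/

section Trees

variable {V : Type*} {G : SimpleGraph V}

theorem eq_univ_of_adj_closed (hG : G.Connected) {D : Set V} (hne : D.Nonempty)
    (hD : ∀ v ∈ D, ∀ w, G.Adj v w → w ∈ D) (x : V) : x ∈ D := by
  obtain ⟨r, hr⟩ := hne
  obtain ⟨p⟩ := hG.preconnected r x
  induction p with
  | nil => exact hr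
  | cons h p ih => exact ih (hD _ hr _ h)

theorem parent_unique (hG : G.IsTree) (r : V) {v w x : V} (hw : G.Adj w v) (hx : G.Adj x v)
    (hw' : G.dist r w < G.dist r v) (hx' : G.dist r x < G.dist r v) : w = x := by
  have key : ∀ w, G.Adj w v → G.dist r w < G.dist r v →
      ∃ p : G.Walk r v, p.IsPath ∧ p.penultimate = w := by
    intro w hw hlt
    obtain ⟨p, hp⟩ := hG.connected.exists_walk_length_eq_dist r w
    refine ⟨p.concat hw, ?_, by simp⟩
    apply SimpleGraph.Walk.isPath_of_length_eq_dist
    have h1 := SimpleGraph.dist_le (p.concat hw)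
    rw [SimpleGraph.Walk.length_concat] at *
    omega
  obtain ⟨p, hp, rfl⟩ := key w hw hw'
  obtain ⟨q, hq, rfl⟩ := key x hx hx'
  have := congrArg Subtype.val ((hG.isAcyclic.subsingleton_path r v).elim ⟨p, hp⟩ ⟨q, hq⟩)
  simp only at this
  rw [this]

/-- A nonempty finite set of vertices of a tree has a vertex with at most one neighbour in it. -/
theorem exists_mem_neighbors_subsingleton (hG : G.IsTree) {D : Set V} (hfin : D.Finite)
    (hne : D.Nonempty) :
    ∃ v ∈ D, ∀ w ∈ D, ∀ x ∈ D, G.Adj v w → G.Adj v x → w = x := by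
  obtain ⟨r, hr⟩ := hne
  obtain ⟨v, hv, hmax⟩ := Set.exists_max_image D (G.dist r) hfin ⟨r, hr⟩
  refine ⟨v, hv, fun w hw x hx hvw hvx => ?_⟩
  refine parent_unique hG r hvw.symm hvx.symm ?_ ?_
  · exact lt_of_le_of_ne (hmax w hw) (hG.dist_ne_of_adj r hvw).symm
  · exact lt_of_le_of_ne (hmax x hx) (hG.dist_ne_of_adj r hvx).symm

theorem isTree_of_parent [Finite V] (r : V) (p : V → V) (rank : V → ℕ)
    (hadj : ∀ v, v ≠ r → G.Adj v (p v)) (hrank : ∀ v, v ≠ r → rank (p v) < rank v)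
    (hcover : ∀ v w, G.Adj v w → (v ≠ r ∧ p v = w) ∨ (w ≠ r ∧ p w = v)) : G.IsTree := by
  have hreach : ∀ m v, rank v = m → G.Reachable r v := by
    intro m
    induction m using Nat.strong_induction_on with
    | _ m ih =>
      intro v hv
      by_cases h : v = r
      · rw [h]
      · exact (ih _ (hv ▸ hrank v h) _ rfl).trans (hadj v h).symm.reachable
  have hconn : G.Connected := by
    have : Nonempty V := ⟨r⟩
    exact ⟨fun v w => (hreach _ v rfl).symm.trans (hreach _ w rfl)⟩
  rw [SimpleGraph.isTree_iff_connected_and_card]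
  refine ⟨hconn, le_antisymm ?_ hconn.card_vert_le_card_edgeSet_add_one⟩
  have hsub : G.edgeSet ⊆ (fun v => s(v, p v)) '' {r}ᶜ := by
    intro e
    induction e with
    | _ v w =>
      intro h
      rcases hcover v w h with ⟨h1, h2⟩ | ⟨h1, h2⟩
      · exact ⟨v, h1, by simp [h2]⟩
      · exact ⟨w, h1, by simp [h2, Sym2.eq_swap]⟩
  have h1 : Nat.card G.edgeSet ≤ ({r}ᶜ : Set V).ncard :=
    (Set.ncard_le_ncard hsub (Set.toFinite _)).trans (Set.ncard_image_le (Set.toFinite _))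
  have h2 := Set.ncard_add_ncard_compl ({r} : Set V)
  rw [Set.ncard_singleton] at h2
  omega

theorem card_edgeSet_of_isTree [Finite V] (hG : G.IsTree) :
    Nat.card G.edgeSet + 1 = Nat.card V :=
  (SimpleGraph.isTree_iff_connected_and_card.1 hG).2

/-- An injective homomorphism between trees of the same order is an isomorphism. -/
theorem nonempty_iso_of_injective_hom {W : Type*} [Finite V] [Finite W] {H : SimpleGraph W}
    (hG : G.IsTree) (hH : H.IsTree) (hcard : Nat.card V = Nat.card W) (f : V → W)
    (hf : Function.Injective f) (hadj : ∀ v w, G.Adj v w → H.Adj (f v) (f w)) :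
    Nonempty (G ≃g H) := by
  have hbij : Function.Bijective f := by
    exact (Nat.bijective_iff_injective_and_card f).2 ⟨hf, hcard⟩
  let F : G →g H := ⟨f, fun {v w} h => hadj v w h⟩
  have hE : Function.Bijective F.mapEdgeSet := by
    refine (Nat.bijective_iff_injective_and_card _).2 ⟨SimpleGraph.Hom.mapEdgeSet.injective F hf, ?_⟩
    have h1 := card_edgeSet_of_isTree hG
    have h2 := card_edgeSet_of_isTree hH
    omega
  refine ⟨⟨Equiv.ofBijective f hbij, fun {v w} => ⟨fun h => ?_, hadj v w⟩⟩⟩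
  obtain ⟨⟨e, he⟩, hee⟩ := hE.2 ⟨s(f v, f w), h⟩
  have hee' : Sym2.map f e = s(f v, f w) := congrArg Subtype.val hee
  have : e = s(v, w) := Sym2.map.injective hf (by simpa using hee')
  rw [this] at he
  exact he

theorem deg_eq_degree [Fintype V] (v : V) : deg G v = G.degree v := by
  rw [deg, Set.ncard_eq_toFinset_card', SimpleGraph.degree]
  congr 1

theorem deg_iso {W : Type*} {H : SimpleGraph W} (f : G ≃g H) (v : V) : deg H (f v) = deg G v := by
  unfold deg
  have : H.neighborSet (f v) = f '' G.neighborSet v := by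
    ext w
    constructor
    · intro h
      exact ⟨f.symm w, by
        simpa using f.symm.map_adj_iff.2 h, by simp⟩
    · rintro ⟨x, hx, rfl⟩
      exact f.map_adj_iff.2 hx
  rw [this, Set.ncard_image_of_injective _ f.injective]

theorem sum_deg [Fintype V] (hG : G.IsTree) : ∑ v, deg G v + 2 = 2 * Fintype.card V := by
  have h := G.sum_degrees_eq_twice_card_edges
  have h2 := hG.card_edgeFinset
  simp only [deg_eq_degree]
  rw [h]
  omega

theorem one_le_deg_of_adj [Finite V] {v w : V} (h : G.Adj v w) : 1 ≤ deg G v :=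
  (Set.ncard_pos (Set.toFinite _)).2 ⟨w, h⟩

theorem one_le_deg [Finite V] (hG : G.IsTree) (h2 : 2 ≤ Nat.card V) (v : V) : 1 ≤ deg G v := by
  have : Nontrivial V := Finite.one_lt_card_iff_nontrivial.1 h2
  obtain ⟨w, hw⟩ := hG.connected.preconnected.exists_adj_of_nontrivial v
  exact one_le_deg_of_adj hw

theorem two_le_deg [Finite V] {v w x : V} (hw : G.Adj v w) (hx : G.Adj v x) (h : w ≠ x) :
    2 ≤ deg G v := by
  rw [← Set.ncard_pair h]
  exact Set.ncard_le_ncard (by rintro y (rfl | rfl) <;> assumption) (Set.toFinite _)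

theorem eq_of_deg_eq_one [Finite V] {v w x : V} (hv : deg G v = 1) (hw : G.Adj v w)
    (hx : G.Adj v x) : w = x := by
  by_contra h
  have := two_le_deg hw hx h
  omega

theorem eq_or_eq_of_deg_eq_two [Finite V] {v w x y : V} (hv : deg G v = 2) (hw : G.Adj v w)
    (hx : G.Adj v x) (h : w ≠ x) (hy : G.Adj v y) : y = w ∨ y = x := by
  have h1 : ({w, x} : Set V) = G.neighborSet v := by
    apply Set.eq_of_subset_of_ncard_le
    · rintro y (rfl | rfl) <;> assumption
    · rw [Set.ncard_pair h]; exact hv.le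
    · exact Set.toFinite _
  have : y ∈ ({w, x} : Set V) := h1 ▸ hy
  simpa using this

theorem deg_lt_card [Finite V] [Nonempty V] (v : V) : deg G v < Nat.card V := by
  have h2 := Set.ncard_add_ncard_compl ({v} : Set V)
  rw [Set.ncard_singleton] at h2
  have : deg G v ≤ ({v}ᶜ : Set V).ncard :=
    Set.ncard_le_ncard (fun w hw => by
      simp only [Set.mem_compl_iff, Set.mem_singleton_iff]
      rintro rfl
      exact G.loopless.irrefl _ hw) (Set.toFinite _)
  omega

/-- In a tree of order at least three, two leaves are not adjacent. -/
theorem three_le_deg_add_deg [Finite V] (hG : G.IsTree) (h3 : 3 ≤ Nat.card V) {v w : V}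
    (h : G.Adj v w) : 3 ≤ deg G v + deg G w := by
  by_contra hlt
  have h1 := one_le_deg_of_adj h
  have h2 := one_le_deg_of_adj h.symm
  have hv : deg G v = 1 := by omega
  have hw : deg G w = 1 := by omega
  have hD := eq_univ_of_adj_closed hG.connected (D := {v, w}) ⟨v, by simp⟩ (by
    rintro a (rfl | rfl) b hb
    · rw [eq_of_deg_eq_one hv hb h]; simp
    · rw [eq_of_deg_eq_one hw hb h.symm]; simp)
  have : Nat.card V ≤ 2 := by
    rw [← Set.ncard_univ, ← Set.eq_univ_of_forall hD]
    exact (Set.ncard_insert_le _ _).trans (by simp)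
  omega

theorem pathGraph_isTree {n : ℕ} (hn : 1 ≤ n) : (SimpleGraph.pathGraph n).IsTree := by
  refine isTree_of_parent (⟨0, hn⟩ : Fin n) (fun i => ⟨i - 1, by omega⟩) (fun i => i) ?_ ?_ ?_
  · intro v hv
    have : v.1 ≠ 0 := fun h => hv (Fin.ext h)
    rw [SimpleGraph.pathGraph_adj]
    simp only
    omega
  · intro v hv
    have : v.1 ≠ 0 := fun h => hv (Fin.ext h)
    simp only
    omega
  · intro v w h
    rw [SimpleGraph.pathGraph_adj] at h
    simp only [ne_eq, Fin.ext_iff]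
    omega

/-- A tree all of whose degrees are at most two is a path. -/
theorem nonempty_iso_pathGraph [Finite V] (hG : G.IsTree) (hdeg : ∀ v, deg G v ≤ 2) :
    Nonempty (G ≃g SimpleGraph.pathGraph (Nat.card V)) := by
  have := Fintype.ofFinite V
  have : Nonempty V := hG.connected.nonempty
  obtain ⟨r, hr⟩ : ∃ r, deg G r ≤ 1 := by
    by_contra! h
    have h1 := sum_deg hG
    have h2 : ∑ v : V, 2 ≤ ∑ v, deg G v := Finset.sum_le_sum fun v _ => h v
    simp at h2
    omega
  have hpar : ∀ v, ∀ d, G.dist r v = d + 1 → ∃ u, G.Adj u v ∧ G.dist r u = d := by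
    intro v d hd
    obtain ⟨p, hp⟩ := hG.connected.exists_walk_length_eq_dist v r
    rw [SimpleGraph.dist_comm, hd] at hp
    cases p with
    | nil => simp at hp
    | @cons _ u _ h p =>
      refine ⟨u, h.symm, ?_⟩
      have h1 := SimpleGraph.dist_le p
      rw [SimpleGraph.Walk.length_cons] at hp
      rw [SimpleGraph.dist_comm] at h1
      rcases hG.dist_eq_dist_add_one_of_adj r h with h | h <;> omega
  have hinj : ∀ d v w, G.dist r v = d → G.dist r w = d → v = w := by
    intro d
    induction d with
    | zero =>
      intro v w hv hw
      rw [hG.connected.dist_eq_zero_iff] at hv hw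
      rw [← hv, ← hw]
    | succ d ih =>
      intro v w hv hw
      obtain ⟨a, ha, had⟩ := hpar v d hv
      obtain ⟨b, hb, hbd⟩ := hpar w d hw
      obtain rfl := ih a b had hbd
      by_contra hvw
      have h2 := two_le_deg ha hb hvw
      have h2' : deg G a = 2 := le_antisymm (hdeg a) h2
      cases d with
      | zero =>
        rw [hG.connected.dist_eq_zero_iff] at had
        subst had
        omega
      | succ d =>
        obtain ⟨c, hc, hcd⟩ := hpar a d had
        rcases eq_or_eq_of_deg_eq_two h2' ha hb hvw hc.symm with rfl | rfl <;> omega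
  have hlt : ∀ v, G.dist r v < Nat.card V := by
    intro v
    obtain ⟨p, hp, hl⟩ := hG.connected.exists_path_of_dist r v
    rw [← hl, Nat.card_eq_fintype_card]
    exact hp.length_lt
  refine nonempty_iso_of_injective_hom hG (pathGraph_isTree Nat.card_pos) (by simp)
    (fun v => ⟨G.dist r v, hlt v⟩) ?_ ?_
  · intro v w h
    exact hinj _ v w (Fin.ext_iff.1 h) rfl
  · intro v w h
    rw [SimpleGraph.pathGraph_adj]
    simp only
    rcases hG.dist_eq_dist_add_one_of_adj r h with h | h <;> omega

/-- A proper two-colouring of a tree by signs. -/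
theorem exists_sign (hG : G.IsTree) :
    ∃ f : V → ℤ, (∀ v, f v = 1 ∨ f v = -1) ∧ ∀ v w, G.Adj v w → f v + f w = 0 := by
  obtain ⟨C⟩ := hG.colorable_two
  refine ⟨fun v => if C v = 0 then 1 else -1, fun v => ?_, fun v w h => ?_⟩
  · dsimp only; split_ifs <;> simp
  · have := C.valid h
    dsimp only
    split_ifs with h1 h2 h2
    · exact absurd (h1.trans h2.symm) this
    · rfl
    · rfl
    · exact absurd (by omega) this

end Trees

/-! ## Matchings -/

section Matchings

variable {V : Type*} {G : SimpleGraph V} {M M' : Finset (Sym2 V)}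

theorem mem_matchings_iff : M ∈ matchings G ↔
    (∀ v w, s(v, w) ∈ M → G.Adj v w) ∧ ∀ v w x, s(v, w) ∈ M → s(v, x) ∈ M → w = x := by
  constructor
  · rintro ⟨h1, h2⟩
    refine ⟨fun v w h => h1 _ h, fun v w x hw hx => ?_⟩
    by_contra hne
    exact h2 _ hw _ hx (fun h => hne (Sym2.congr_right.1 h)) v ⟨by simp, by simp⟩
  · rintro ⟨h1, h2⟩
    refine ⟨fun e => ?_, fun e he f hf hne x hx => ?_⟩
    · induction e with
      | _ v w => exact h1 v w
    · obtain ⟨⟨y, rfl⟩, ⟨z, rfl⟩⟩ := hx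
      exact hne (by rw [h2 x y z he hf])

theorem adj_of_mem (hM : M ∈ matchings G) {v w : V} (h : s(v, w) ∈ M) : G.Adj v w :=
  (mem_matchings_iff.1 hM).1 v w h

theorem eq_of_mem (hM : M ∈ matchings G) {v w x : V} (h : s(v, w) ∈ M) (h' : s(v, x) ∈ M) :
    w = x :=
  (mem_matchings_iff.1 hM).2 v w x h h'

/-- The vertices covered by a set of edges. -/
noncomputable def cov (M : Finset (Sym2 V)) : Finset V := M.biUnion Sym2.toFinset

theorem mem_cov {v : V} : v ∈ cov M ↔ ∃ w, s(v, w) ∈ M := by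
  simp only [cov, Finset.mem_biUnion, Sym2.mem_toFinset]
  constructor
  · rintro ⟨e, he, w, rfl⟩
    exact ⟨w, he⟩
  · rintro ⟨w, h⟩
    exact ⟨_, h, by simp⟩

theorem mem_cov_left {v w : V} (h : s(v, w) ∈ M) : v ∈ cov M := mem_cov.2 ⟨w, h⟩

theorem mem_cov_right {v w : V} (h : s(v, w) ∈ M) : w ∈ cov M :=
  mem_cov.2 ⟨v, by rwa [Sym2.eq_swap]⟩

theorem pairwiseDisjoint_toFinset (hM : M ∈ matchings G) :
    (M : Set (Sym2 V)).PairwiseDisjoint Sym2.toFinset := by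
  intro e he f hf hne
  rw [Function.onFun, Finset.disjoint_left]
  intro x hx hx'
  exact hM.2 e he f hf hne x ⟨Sym2.mem_toFinset.1 hx, Sym2.mem_toFinset.1 hx'⟩

@[to_additive]
theorem prod_cov {R : Type*} [CommMonoid R] (hM : M ∈ matchings G) (f : V → R) :
    ∏ v ∈ cov M, f v = ∏ e ∈ M, ∏ v ∈ e.toFinset, f v :=
  Finset.prod_biUnion (pairwiseDisjoint_toFinset hM)

@[to_additive]
theorem prod_toFinset {R : Type*} [CommMonoid R] {v w : V} (h : v ≠ w) (f : V → R) :
    ∏ x ∈ s(v, w).toFinset, f x = f v * f w := by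
  have : s(v, w).toFinset = {v, w} := by
    ext x; simp
  rw [this, Finset.prod_pair h]

theorem card_cov (hM : M ∈ matchings G) : (cov M).card = 2 * M.card := by
  rw [cov, Finset.card_biUnion (fun e he f hf h => pairwiseDisjoint_toFinset hM he hf h)]
  rw [Finset.sum_congr rfl (g := fun _ => 2), Finset.sum_const, smul_eq_mul, mul_comm]
  intro e he
  exact Sym2.card_toFinset_of_not_isDiag e (G.not_isDiag_of_mem_edgeSet (hM.1 e he))

/-- In a tree a matching is determined by the vertices it covers. -/
theorem eq_of_cov_eq [Finite V] (hG : G.IsTree) (hM : M ∈ matchings G) (hM' : M' ∈ matchings G)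
    (h : cov M = cov M') : M = M' := by
  by_contra hne
  let D : Set V := {v | ∃ w, (s(v, w) ∈ M ∧ s(v, w) ∉ M') ∨ (s(v, w) ∈ M' ∧ s(v, w) ∉ M)}
  have hD : D.Nonempty := by
    have : ∃ e, (e ∈ M ∧ e ∉ M') ∨ (e ∈ M' ∧ e ∉ M) := by
      by_contra! h
      exact hne (Finset.ext fun e => ⟨fun h1 => (h e).1 h1, fun h1 => (h e).2 h1⟩)
    obtain ⟨e, he⟩ := this
    induction e with
    | _ v w => exact ⟨v, w, he⟩
  obtain ⟨v, ⟨w, hw⟩, hu⟩ := exists_mem_neighbors_subsingleton hG (Set.toFinite D) hD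
  have key : ∀ {M M' : Finset (Sym2 V)} {w : V}, M ∈ matchings G → M' ∈ matchings G →
      cov M = cov M' → s(v, w) ∈ M → s(v, w) ∉ M' →
      ∃ x, x ≠ w ∧ s(v, x) ∈ M' ∧ s(v, x) ∉ M := by
    intro M M' w hM hM' h h1 h2
    obtain ⟨x, hx⟩ := mem_cov.1 (h ▸ mem_cov_left h1)
    have hxw : x ≠ w := fun h => h2 (h ▸ hx)
    exact ⟨x, hxw, hx, fun h3 => hxw (eq_of_mem hM h3 h1)⟩
  have hD1 : ∀ x, s(v, x) ∈ M → s(v, x) ∉ M' → x ∈ D := fun x h1 h2 =>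
    ⟨v, Or.inl ⟨by rwa [Sym2.eq_swap], by rwa [Sym2.eq_swap]⟩⟩
  have hD2 : ∀ x, s(v, x) ∈ M' → s(v, x) ∉ M → x ∈ D := fun x h1 h2 =>
    ⟨v, Or.inr ⟨by rwa [Sym2.eq_swap], by rwa [Sym2.eq_swap]⟩⟩
  rcases hw with ⟨h1, h2⟩ | ⟨h1, h2⟩
  · obtain ⟨x, hx, h3, h4⟩ := key hM hM' h h1 h2
    exact hx (hu x (hD2 x h3 h4) w (hD1 w h1 h2) (adj_of_mem hM' h3) (adj_of_mem hM h1))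
  · obtain ⟨x, hx, h3, h4⟩ := key hM' hM h.symm h1 h2
    exact hx (hu x (hD1 x h3 h4) w (hD2 w h1 h2) (adj_of_mem hM h3) (adj_of_mem hM' h1))

/-- The sum of the degrees of the ends of an edge. -/
noncomputable def degSum (G : SimpleGraph V) : Sym2 V → ℕ :=
  Sym2.lift ⟨fun x y => deg G x + deg G y, fun _ _ => add_comm _ _⟩

/-- The product of the degrees of the ends of an edge. -/
noncomputable def degProd (G : SimpleGraph V) : Sym2 V → ℕ :=
  Sym2.lift ⟨fun x y => deg G x * deg G y, fun _ _ => mul_comm _ _⟩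

@[simp] theorem degSum_mk (x y : V) : degSum G s(x, y) = deg G x + deg G y := rfl

@[simp] theorem degProd_mk (x y : V) : degProd G s(x, y) = deg G x * deg G y := rfl

theorem sum_cov_deg (hM : M ∈ matchings G) : ∑ v ∈ cov M, deg G v = ∑ e ∈ M, degSum G e := by
  rw [sum_cov hM]
  refine Finset.sum_congr rfl fun e he => ?_
  induction e with
  | _ v w => rw [sum_toFinset (adj_of_mem hM he).ne, degSum_mk]

theorem prod_cov_deg (hM : M ∈ matchings G) :
    ∏ v ∈ cov M, deg G v = ∏ e ∈ M, degProd G e := by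
  rw [prod_cov hM]
  refine Finset.prod_congr rfl fun e he => ?_
  induction e with
  | _ v w => rw [prod_toFinset (adj_of_mem hM he).ne, degProd_mk]

theorem sum_cov_sign (hM : M ∈ matchings G) {f : V → ℤ} (hf : ∀ v w, G.Adj v w → f v + f w = 0) :
    ∑ v ∈ cov M, f v = 0 := by
  rw [sum_cov hM]
  refine Finset.sum_eq_zero fun e he => ?_
  induction e with
  | _ v w =>
    have h := adj_of_mem hM he
    rw [sum_toFinset h.ne, hf v w h]

section Fin

variable [Fintype V]

/-- The finset of matchings. -/
noncomputable def matchF (G : SimpleGraph V) : Finset (Finset (Sym2 V)) :=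
  univ.filter (· ∈ matchings G)

@[simp] theorem mem_matchF : M ∈ matchF G ↔ M ∈ matchings G := by simp [matchF]

theorem card_matchF_le (hG : G.IsTree) : (matchF G).card ≤ 2 ^ Fintype.card V := by
  rw [← Fintype.card_finset]
  refine Finset.card_le_card_of_injOn cov (fun _ _ => Finset.mem_univ _) ?_
  intro M hM M' hM' h
  exact eq_of_cov_eq hG (mem_matchF.1 hM) (mem_matchF.1 hM') h

/-- The vertices not covered by a set of edges. -/
noncomputable def missed (M : Finset (Sym2 V)) : Finset V := univ.filter (· ∉ cov M)

@[simp] theorem mem_missed {v : V} : v ∈ missed M ↔ v ∉ cov M := by simp [missed]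

@[to_additive]
theorem prod_cov_mul_prod_missed {R : Type*} [CommMonoid R] (f : V → R) :
    (∏ v ∈ cov M, f v) * ∏ v ∈ missed M, f v = ∏ v, f v := by
  rw [missed, ← Finset.prod_filter_mul_prod_filter_not univ (· ∈ cov M)]
  simp

theorem card_missed (hM : M ∈ matchings G) : 2 * M.card + (missed M).card = Fintype.card V := by
  rw [← card_cov hM, missed]
  have := Finset.card_filter_add_card_filter_not (s := (univ : Finset V)) (· ∈ cov M)
  simpa using this

theorem sum_degSum_add (hG : G.IsTree) (hM : M ∈ matchings G) :
    ∑ e ∈ M, degSum G e + ∑ v ∈ missed M, deg G v + 2 = 2 * Fintype.card V := by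
  rw [← sum_cov_deg hM, sum_cov_add_sum_missed, sum_deg hG]

theorem card_missed_le_sum_deg (hG : G.IsTree) (h2 : 2 ≤ Fintype.card V) :
    (missed M).card ≤ ∑ v ∈ missed M, deg G v := by
  rw [Finset.card_eq_sum_ones]
  exact Finset.sum_le_sum fun v _ => one_le_deg hG (by rwa [Nat.card_eq_fintype_card]) v

theorem deg_eq_one_of_sum_missed (hG : G.IsTree) (h2 : 2 ≤ Fintype.card V)
    (h : ∑ v ∈ missed M, deg G v ≤ (missed M).card) {v : V} (hv : v ∉ cov M) : deg G v = 1 := by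
  rw [Finset.card_eq_sum_ones] at h
  have h1 : ∀ v ∈ missed M, 1 ≤ deg G v := fun v _ =>
    one_le_deg hG (by rwa [Nat.card_eq_fintype_card]) v
  have := (Finset.sum_eq_sum_iff_of_le h1).1 (le_antisymm (Finset.sum_le_sum h1) h)
  exact (this v (mem_missed.2 hv)).symm

theorem Z_eq_sum (φ : SymmFun) : Z φ G = ∑ M ∈ matchF G, ∏ e ∈ M, degreeWeight G φ e := by
  rw [Z, weightedHosoya]
  exact finsum_mem_eq_sum_of_inter_support_eq _ (by ext; simp)

theorem Z_phi1 (c : ℝ) : Z (phi1 c) G = ∑ M ∈ matchF G, c ^ (∑ v ∈ cov M, deg G v) := by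
  rw [Z_eq_sum]
  refine Finset.sum_congr rfl fun M hM => ?_
  rw [sum_cov_deg (mem_matchF.1 hM), ← Finset.prod_pow_eq_pow_sum]
  refine Finset.prod_congr rfl fun e _ => ?_
  induction e with
  | _ v w => rfl

theorem Z_phi2 (c : ℝ) : Z (phi2 c) G = ∑ M ∈ matchF G, c ^ (∑ e ∈ M, degProd G e) := by
  rw [Z_eq_sum]
  refine Finset.sum_congr rfl fun M hM => ?_
  rw [← Finset.prod_pow_eq_pow_sum]
  refine Finset.prod_congr rfl fun e _ => ?_
  induction e with
  | _ v w => rfl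

theorem Z_phi3 (c : ℝ) :
    Z (phi3 c) G = ∑ M ∈ matchF G, ((∏ e ∈ M, degSum G e : ℕ) : ℝ) ^ c := by
  rw [Z_eq_sum]
  refine Finset.sum_congr rfl fun M hM => ?_
  rw [Nat.cast_prod, ← Real.finsetProd_rpow _ _ fun e _ => Nat.cast_nonneg _]
  refine Finset.prod_congr rfl fun e _ => ?_
  induction e with
  | _ v w => simp [degreeWeight, phi3]

theorem Z_phi4 (c : ℝ) :
    Z (phi4 c) G = ∑ M ∈ matchF G, ((∏ v ∈ cov M, deg G v : ℕ) : ℝ) ^ c := by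
  rw [Z_eq_sum]
  refine Finset.sum_congr rfl fun M hM => ?_
  rw [prod_cov_deg (mem_matchF.1 hM), Nat.cast_prod,
    ← Real.finsetProd_rpow _ _ fun e _ => Nat.cast_nonneg _]
  refine Finset.prod_congr rfl fun e _ => ?_
  induction e with
  | _ v w => simp [degreeWeight, phi4]

end Fin

theorem image_mem_matchings {W : Type*} {H : SimpleGraph W} (hM : M ∈ matchings G) {f : V → W}
    (hf : Function.Injective f) (hadj : ∀ v w, G.Adj v w → H.Adj (f v) (f w)) :
    M.image (Sym2.map f) ∈ matchings H := by
  refine ⟨?_, ?_⟩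
  · simp only [Finset.mem_image]
    rintro _ ⟨e, he, rfl⟩
    induction e with
    | _ v w => exact hadj v w (adj_of_mem hM he)
  · simp only [Finset.mem_image]
    rintro _ ⟨e, he, rfl⟩ _ ⟨e', he', rfl⟩ hne x ⟨hx, hx'⟩
    obtain ⟨y, hy, rfl⟩ := Sym2.mem_map.1 hx
    obtain ⟨z, hz, hzy⟩ := Sym2.mem_map.1 hx'
    obtain rfl := hf hzy
    exact hM.2 e he e' he' (fun h => hne (by rw [h])) z ⟨hy, hz⟩

/-- The index is invariant under isomorphism. -/
theorem Z_iso {W : Type*} {H : SimpleGraph W} [Finite V] [Finite W] (φ : SymmFun) (f : G ≃g H) :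
    Z φ G = Z φ H := by
  have := Fintype.ofFinite V
  have := Fintype.ofFinite W
  rw [Z_eq_sum, Z_eq_sum]
  refine Finset.sum_nbij' (fun M => M.image (Sym2.map f)) (fun M => M.image (Sym2.map f.symm))
    ?_ ?_ ?_ ?_ ?_
  · intro M hM
    exact mem_matchF.2 (image_mem_matchings (mem_matchF.1 hM) f.injective
      fun v w h => f.map_adj_iff.2 h)
  · intro M hM
    exact mem_matchF.2 (image_mem_matchings (mem_matchF.1 hM) f.symm.injective
      fun v w h => f.symm.map_adj_iff.2 h)
  · intro M _
    simp [Finset.image_image, Sym2.map_comp.symm]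
  · intro M _
    simp [Finset.image_image, Sym2.map_comp.symm]
  · intro M _
    rw [Finset.prod_image fun e _ e' _ h => Sym2.map.injective f.injective h]
    refine Finset.prod_congr rfl fun e _ => ?_
    induction e with
    | _ v w => simp [degreeWeight, deg_iso]

end Matchings

/-! ## Unique maximizers -/

section Maximizers

theorem isUniqueMaximizer_of_lt {V : Type v} [Finite V] {φ : SymmFun} {n : ℕ} {G : SimpleGraph V}
    (hG : G.IsTree) (hn : Nat.card V = n)
    (h : ∀ (U : Type u) [Fintype U] (T : SimpleGraph U), T.IsTree → Fintype.card U = n →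
      IsEmpty (T ≃g G) → Z φ T < Z φ G) : IsUniqueMaximizer.{u, v} φ n G := by
  refine ⟨hG, hn, fun U _ T hT hU => ?_⟩
  have := Fintype.ofFinite U
  rcases isEmpty_or_nonempty (T ≃g G) with hiso | hiso
  · have := h U T hT (by rwa [← Nat.card_eq_fintype_card]) hiso
    exact ⟨this.le, fun h => absurd h this.ne⟩
  · exact ⟨(Z_iso φ hiso.some).le, fun _ => hiso⟩

theorem IsUniqueMaximizer.of_iso {V W : Type v} [Finite V] [Finite W] {φ : SymmFun} {n : ℕ}
    {G : SimpleGraph V} {H : SimpleGraph W} (h : IsUniqueMaximizer.{u, v} φ n G) (f : G ≃g H) :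
    IsUniqueMaximizer.{u, v} φ n H := by
  obtain ⟨h1, h2, h3⟩ := h
  refine ⟨f.isTree_iff.1 h1, (Nat.card_congr f.toEquiv).symm.trans h2, fun U _ T hT hU => ?_⟩
  rw [← Z_iso φ f]
  exact ⟨(h3 U T hT hU).1, fun h => ⟨((h3 U T hT hU).2 h).some.trans f⟩⟩

theorem sum_lt_of_exceptional {ι : Type*} {s t : Finset ι} (ht : t ⊆ s) {f : ι → ℝ} {A B L : ℝ}
    {m N : ℕ} (hN : s.card ≤ N) (hm : t.card ≤ m) (hA0 : 0 ≤ A) (hB0 : 0 ≤ B)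
    (hA : ∀ i ∈ t, f i ≤ A) (hB : ∀ i ∈ s, i ∉ t → f i ≤ B) (hL : N * B < L) :
    ∑ i ∈ s, f i < m * A + L := by
  rw [← Finset.sum_sdiff ht, add_comm]
  have h1 : ∑ i ∈ t, f i ≤ m * A := by
    refine (Finset.sum_le_card_nsmul t f A hA).trans ?_
    rw [nsmul_eq_mul]
    gcongr
  have h2 : ∑ i ∈ s \ t, f i ≤ N * B := by
    refine (Finset.sum_le_card_nsmul (s \ t) f B fun i hi => ?_).trans ?_
    · rw [Finset.mem_sdiff] at hi
      exact hB i hi.1 hi.2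
    · rw [nsmul_eq_mul]
      gcongr
      exact (Finset.card_le_card Finset.sdiff_subset).trans hN
  linarith

theorem sum_lt_of_forall {ι : Type*} {s : Finset ι} {f : ι → ℝ} {B L : ℝ} {N : ℕ}
    (hN : s.card ≤ N) (hB0 : 0 ≤ B) (hB : ∀ i ∈ s, f i ≤ B) (hL : N * B < L) :
    ∑ i ∈ s, f i < L := by
  have := sum_lt_of_exceptional (t := ∅) (A := 0) (m := 0) (by simp) hN (by simp) le_rfl hB0
    (by simp) (fun i hi _ => hB i hi) hL
  simpa using this

theorem eventually_mul_rpow_lt (N : ℕ) {a b : ℝ} (ha : 0 ≤ a) (hab : a < b) :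
    ∀ᶠ c : ℝ in Filter.atTop, N * a ^ c < b ^ c := by
  have hb : 0 < b := ha.trans_lt hab
  have h := tendsto_rpow_atTop_of_base_lt_one (a / b)
    (by linarith [div_nonneg ha hb.le]) ((div_lt_one hb).2 hab)
  have h2 := (h.const_mul (N : ℝ)).eventually_lt_const (u := 1) (by simp)
  filter_upwards [h2] with c hc
  rw [Real.div_rpow ha hb.le, mul_div_assoc', div_lt_one (Real.rpow_pos_of_pos hb c)] at hc
  exact hc

theorem eventually_mul_natPred_rpow_lt (N : ℕ) {K : ℕ} (hK : 1 ≤ K) :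
    ∀ᶠ c : ℝ in Filter.atTop, N * ((K - 1 : ℕ) : ℝ) ^ c < (K : ℝ) ^ c :=
  eventually_mul_rpow_lt N (Nat.cast_nonneg _) (by exact_mod_cast Nat.sub_lt hK one_pos)

theorem mul_pow_lt_pow_succ {c : ℝ} {N : ℕ} (hc : (N : ℝ) + 1 ≤ c) (m : ℕ) :
    N * c ^ m < c ^ (m + 1) := by
  have hc0 : (0 : ℝ) < c := by have := Nat.cast_nonneg (α := ℝ) N; linarith
  rw [pow_succ, mul_comm]
  have := pow_pos hc0 m
  nlinarith

end Maximizers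

/-! ## Paths -/

section Path

/-- The edges `i, i + 1` of the path, for `i` with the property `I`. -/
noncomputable def pathEdges (n : ℕ) (I : ℕ → Prop) : Finset (Sym2 (Fin n)) :=
  univ.filter fun e => ∃ (i : ℕ) (h : i + 1 < n), I i ∧ e = s(⟨i, by omega⟩, ⟨i + 1, h⟩)

theorem mem_pathEdges {n : ℕ} {I : ℕ → Prop} {v w : Fin n} :
    s(v, w) ∈ pathEdges n I ↔ (I v ∧ w.1 = v + 1) ∨ (I w ∧ v.1 = w + 1) := by
  simp only [pathEdges, Finset.mem_filter, Finset.mem_univ, true_and, Sym2.eq_iff, Fin.ext_iff]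
  constructor
  · rintro ⟨i, h, hi, ⟨h1, h2⟩ | ⟨h1, h2⟩⟩
    · exact Or.inl ⟨h1 ▸ hi, by omega⟩
    · exact Or.inr ⟨h2 ▸ hi, by omega⟩
  · rintro (⟨h1, h2⟩ | ⟨h1, h2⟩)
    · exact ⟨v, by omega, h1, Or.inl ⟨rfl, h2⟩⟩
    · exact ⟨w, by omega, h1, Or.inr ⟨h2, rfl⟩⟩

theorem pathEdges_mem_matchings {n : ℕ} {I : ℕ → Prop} (hI : ∀ i, I i → ¬ I (i + 1)) :
    pathEdges n I ∈ matchings (SimpleGraph.pathGraph n) := by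
  rw [mem_matchings_iff]
  refine ⟨fun v w h => ?_, fun v w x hw hx => ?_⟩
  · rw [mem_pathEdges] at h
    rw [SimpleGraph.pathGraph_adj]
    omega
  · rw [mem_pathEdges] at hw hx
    rw [Fin.ext_iff]
    rcases hw with ⟨h1, h2⟩ | ⟨h1, h2⟩ <;> rcases hx with ⟨h3, h4⟩ | ⟨h3, h4⟩
    · omega
    · rw [h4] at h1
      exact absurd h1 (hI _ h3)
    · rw [h2] at h3
      exact absurd h3 (hI _ h1)
    · omega

theorem mem_cov_pathEdges {n : ℕ} {I : ℕ → Prop} {v : Fin n} :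
    v ∈ cov (pathEdges n I) ↔ (I v ∧ v.1 + 1 < n) ∨ ∃ i, I i ∧ v.1 = i + 1 := by
  simp only [mem_cov, mem_pathEdges]
  constructor
  · rintro ⟨w, ⟨h1, h2⟩ | ⟨h1, h2⟩⟩
    · exact Or.inl ⟨h1, by omega⟩
    · exact Or.inr ⟨w, h1, h2⟩
  · rintro (⟨h1, h2⟩ | ⟨i, h1, h2⟩)
    · exact ⟨⟨v + 1, h2⟩, Or.inl ⟨h1, rfl⟩⟩
    · exact ⟨⟨i, by omega⟩, Or.inr ⟨h1, h2⟩⟩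

theorem deg_pathGraph_le {n : ℕ} (v : Fin n) : deg (SimpleGraph.pathGraph n) v ≤ 2 := by
  have hsub : Fin.val '' (SimpleGraph.pathGraph n).neighborSet v ⊆ {v.1 - 1, v.1 + 1} := by
    rintro _ ⟨w, hw, rfl⟩
    rw [SimpleGraph.mem_neighborSet, SimpleGraph.pathGraph_adj] at hw
    simp only [Set.mem_insert_iff, Set.mem_singleton_iff]
    omega
  rw [deg, ← Set.ncard_image_of_injective _ Fin.val_injective]
  exact (Set.ncard_le_ncard hsub (Set.toFinite _)).trans
    ((Set.ncard_insert_le _ _).trans (by simp))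

theorem deg_pathGraph_end {n : ℕ} (hn : 2 ≤ n) (v : Fin n) (hv : v.1 = 0 ∨ v.1 = n - 1) :
    deg (SimpleGraph.pathGraph n) v = 1 := by
  refine le_antisymm ?_ (one_le_deg (pathGraph_isTree (by omega)) (by simpa) v)
  have hsub : Fin.val '' (SimpleGraph.pathGraph n).neighborSet v ⊆
      {if v.1 = 0 then 1 else n - 2} := by
    rintro _ ⟨w, hw, rfl⟩
    rw [SimpleGraph.mem_neighborSet, SimpleGraph.pathGraph_adj] at hw
    have := w.2
    simp only [Set.mem_singleton_iff]
    split_ifs <;> omega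
  rw [deg, ← Set.ncard_image_of_injective _ Fin.val_injective]
  exact (Set.ncard_le_ncard hsub (Set.toFinite _)).trans (by simp)

theorem deg_pathGraph_inner {n : ℕ} (v : Fin n) (h0 : v.1 ≠ 0) (h1 : v.1 + 1 < n) :
    deg (SimpleGraph.pathGraph n) v = 2 := by
  refine le_antisymm (deg_pathGraph_le v) ?_
  refine two_le_deg (w := ⟨v.1 - 1, by omega⟩) (x := ⟨v.1 + 1, h1⟩) ?_ ?_ ?_
  · rw [SimpleGraph.pathGraph_adj]; simp only; omega
  · rw [SimpleGraph.pathGraph_adj]; exact Or.inl rfl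
  · simp only [ne_eq, Fin.ext_iff]; omega

/-- A tree that is not a path has a vertex of degree at least three. -/
theorem exists_three_le_deg {V : Type*} [Fintype V] {T : SimpleGraph V} (hT : T.IsTree) {n : ℕ}
    (hn : Fintype.card V = n) (h : IsEmpty (T ≃g SimpleGraph.pathGraph n)) : ∃ v, 3 ≤ deg T v := by
  by_contra! hdeg
  obtain ⟨f⟩ := nonempty_iso_pathGraph hT fun v => Nat.le_of_lt_succ (hdeg v)
  rw [Nat.card_eq_fintype_card, hn] at f
  exact h.false f

theorem four_le_of_not_path {V : Type*} [Fintype V] {T : SimpleGraph V} (hT : T.IsTree) {n : ℕ}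
    (hn : Fintype.card V = n) (h : IsEmpty (T ≃g SimpleGraph.pathGraph n)) : 4 ≤ n := by
  obtain ⟨v, hv⟩ := exists_three_le_deg hT hn h
  have : Nonempty V := ⟨v⟩
  have := deg_lt_card (G := T) v
  rw [Nat.card_eq_fintype_card] at this
  omega

end Path

/-! ## The weight `(i j) ^ c` -/

section PhiFour

variable {V : Type*} [Fintype V] {T : SimpleGraph V}

theorem sum_deg_sub_one (hT : T.IsTree) (h2 : 2 ≤ Fintype.card V) :
    ∑ v, (deg T v - 1) = Fintype.card V - 2 := by
  have h := sum_deg hT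
  have h1 : ∑ v, (deg T v - 1) + ∑ v : V, 1 = ∑ v, deg T v := by
    rw [← Finset.sum_add_distrib]
    refine Finset.sum_congr rfl fun v _ => ?_
    have := one_le_deg hT (by rwa [Nat.card_eq_fintype_card]) v
    omega
  simp at h1
  omega

theorem le_two_pow_pred (d : ℕ) : d ≤ 2 ^ (d - 1) := by
  cases d with
  | zero => simp
  | succ d => exact Nat.lt_two_pow_self

theorem lt_two_pow_pred {d : ℕ} (h : 3 ≤ d) : d < 2 ^ (d - 1) := by
  obtain ⟨e, rfl⟩ := Nat.exists_eq_add_of_le h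
  have : e < 2 ^ e := Nat.lt_two_pow_self
  rw [show 3 + e - 1 = e + 2 by omega, pow_add]
  omega

theorem prod_cov_deg_lt (hT : T.IsTree) (h2 : 2 ≤ Fintype.card V) (hv : ∃ v, 3 ≤ deg T v)
    (M : Finset (Sym2 V)) : ∏ v ∈ cov M, deg T v < 2 ^ (Fintype.card V - 2) := by
  have hpos : ∀ v, 0 < deg T v := one_le_deg hT (by rwa [Nat.card_eq_fintype_card])
  calc ∏ v ∈ cov M, deg T v ≤ ∏ v, deg T v :=
        Finset.prod_le_prod_of_subset_of_one_le' (Finset.subset_univ _) fun v _ _ => hpos v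
    _ < ∏ v, 2 ^ (deg T v - 1) := by
        obtain ⟨v, hv⟩ := hv
        exact Finset.prod_lt_prod (fun v _ => hpos v) (fun v _ => le_two_pow_pred _)
          ⟨v, Finset.mem_univ v, lt_two_pow_pred hv⟩
    _ = 2 ^ (Fintype.card V - 2) := by
        rw [Finset.prod_pow_eq_pow_sum, sum_deg_sub_one hT h2]

theorem prod_cov_deg_eq (hT : T.IsTree) (h2 : 2 ≤ Fintype.card V) (hdeg : ∀ v, deg T v ≤ 2)
    {M : Finset (Sym2 V)} (hM : ∀ v, v ∉ cov M → deg T v = 1) :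
    ∏ v ∈ cov M, deg T v = 2 ^ (Fintype.card V - 2) := by
  rw [← sum_deg_sub_one hT h2, ← Finset.prod_pow_eq_pow_sum, ← prod_cov_mul_prod_missed (M := M)]
  rw [Finset.prod_eq_one (s := missed M), mul_one]
  · refine Finset.prod_congr rfl fun v _ => ?_
    have h1 := one_le_deg hT (by rwa [Nat.card_eq_fintype_card]) v
    have h2 := hdeg v
    interval_cases deg T v <;> rfl
  · intro v hv
    rw [hM v (mem_missed.1 hv)]
    rfl

theorem phi4_maximizer (n : ℕ) (hn : 1 ≤ n) : ∀ᶠ c : ℝ in Filter.atTop,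
    IsUniqueMaximizer.{u, 0} (phi4 c) n (SimpleGraph.pathGraph n) := by
  filter_upwards [eventually_mul_natPred_rpow_lt (2 ^ n) (K := 2 ^ (n - 2)) Nat.one_le_two_pow,
    Filter.eventually_ge_atTop 0] with c hc hc0
  refine isUniqueMaximizer_of_lt (pathGraph_isTree hn) (by simp) fun U _ T hT hU hiso => ?_
  have h4 := four_le_of_not_path hT hU hiso
  calc Z (phi4 c) T < ((2 ^ (n - 2) : ℕ) : ℝ) ^ c := by
        rw [Z_phi4]
        refine sum_lt_of_forall (hU ▸ card_matchF_le hT) (Real.rpow_nonneg (Nat.cast_nonneg _) c)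
          (fun M _ => ?_) hc
        have := prod_cov_deg_lt hT (by omega) (exists_three_le_deg hT hU hiso) M
        rw [hU] at this
        exact Real.rpow_le_rpow (Nat.cast_nonneg _) (by exact_mod_cast Nat.le_sub_one_of_lt this) hc0
    _ ≤ Z (phi4 c) (SimpleGraph.pathGraph n) := by
        rw [Z_phi4]
        have hM := pathEdges_mem_matchings (n := n) (I := fun i => i % 2 = 0) (by omega)
        have h := prod_cov_deg_eq (pathGraph_isTree hn) (by rw [Fintype.card_fin]; omega)
          deg_pathGraph_le (M := pathEdges n fun i => i % 2 = 0) (by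
            intro v hv
            rw [mem_cov_pathEdges] at hv
            refine deg_pathGraph_end (by omega) v (Or.inr ?_)
            by_contra hne
            refine hv ?_
            rcases Nat.mod_two_eq_zero_or_one v.1 with h | h
            · exact Or.inl ⟨h, by omega⟩
            · exact Or.inr ⟨v.1 - 1, by omega, by omega⟩)
        rw [Fintype.card_fin] at h
        rw [← h]
        exact Finset.single_le_sum (f := fun M => ((∏ v ∈ cov M, deg _ v : ℕ) : ℝ) ^ c)
          (fun M _ => Real.rpow_nonneg (Nat.cast_nonneg _) c) (mem_matchF.2 hM)

end PhiFour

/-! ## The weight `c ^ (i j)` -/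

section PhiTwo

theorem even_sq_div_four (p : ℕ) : (2 * p) ^ 2 / 4 = p * p := by
  rw [show (2 * p) ^ 2 = 4 * (p * p) by ring]
  omega

theorem odd_sq_div_four (p : ℕ) : (2 * p + 1) ^ 2 / 4 = p * (p + 1) := by
  rw [show (2 * p + 1) ^ 2 = 4 * (p * (p + 1)) + 1 by ring]
  omega

theorem sq_div_four (n : ℕ) : n ^ 2 / 4 = n / 2 * ((n + 1) / 2) := by
  rcases Nat.even_or_odd' n with ⟨p, rfl | rfl⟩
  · rw [even_sq_div_four]
    congr 1 <;> omega
  · rw [odd_sq_div_four]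
    congr 1 <;> omega

theorem sq_div_four_add_le {a b : ℕ} (ha : 1 ≤ a) (hb : 1 ≤ b) :
    (a + 2) ^ 2 / 4 + (b + 2) ^ 2 / 4 + (if 4 ≤ a + b then 1 else 0) ≤ (a + b + 2) ^ 2 / 4 := by
  rcases Nat.even_or_odd' a with ⟨p, rfl | rfl⟩ <;> rcases Nat.even_or_odd' b with ⟨q, rfl | rfl⟩
  · rw [show 2 * p + 2 = 2 * (p + 1) by ring, show 2 * q + 2 = 2 * (q + 1) by ring,
      show 2 * p + 2 * q + 2 = 2 * (p + q + 1) by ring]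
    simp only [even_sq_div_four]
    have : 1 ≤ p * q := Nat.mul_pos (by omega) (by omega)
    split_ifs <;> nlinarith
  · rw [show 2 * p + 2 = 2 * (p + 1) by ring, show 2 * q + 1 + 2 = 2 * (q + 1) + 1 by ring,
      show 2 * p + (2 * q + 1) + 2 = 2 * (p + q + 1) + 1 by ring]
    simp only [even_sq_div_four, odd_sq_div_four]
    split_ifs with h
    · rcases Nat.eq_zero_or_pos q with rfl | hq
      · nlinarith
      · nlinarith [Nat.mul_pos (show 0 < p by omega) hq]
    · nlinarith [Nat.zero_le (p * q)]
  · rw [show 2 * p + 1 + 2 = 2 * (p + 1) + 1 by ring, show 2 * q + 2 = 2 * (q + 1) by ring,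
      show 2 * p + 1 + 2 * q + 2 = 2 * (p + q + 1) + 1 by ring]
    simp only [even_sq_div_four, odd_sq_div_four]
    split_ifs with h
    · rcases Nat.eq_zero_or_pos p with rfl | hp
      · nlinarith
      · nlinarith [Nat.mul_pos hp (show 0 < q by omega)]
    · nlinarith [Nat.zero_le (p * q)]
  · rw [show 2 * p + 1 + 2 = 2 * (p + 1) + 1 by ring, show 2 * q + 1 + 2 = 2 * (q + 1) + 1 by ring,
      show 2 * p + 1 + (2 * q + 1) + 2 = 2 * (p + q + 2) by ring]
    simp only [even_sq_div_four, odd_sq_div_four]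
    split_ifs with h
    · nlinarith [Nat.zero_le (p * q)]
    · nlinarith [Nat.zero_le (p * q)]

theorem sum_sq_div_four_le {ι : Type*} (s : Finset ι) (hs : s.Nonempty) (t : ι → ℕ)
    (ht : ∀ e ∈ s, 1 ≤ t e) :
    1 ≤ ∑ e ∈ s, t e ∧ ∑ e ∈ s, (t e + 2) ^ 2 / 4 ≤ (∑ e ∈ s, t e + 2) ^ 2 / 4 := by
  induction hs using Finset.Nonempty.cons_induction with
  | singleton a => simpa using ht a
  | cons a s ha hs ih =>
    rw [Finset.sum_cons, Finset.sum_cons]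
    obtain ⟨h1, h2⟩ := ih fun e he => ht e (Finset.mem_cons_of_mem he)
    have h3 := ht a (Finset.mem_cons_self _ _)
    have h4 := sq_div_four_add_le h3 h1
    exact ⟨by omega, by omega⟩

theorem mul_le_sq_div_four (x y : ℕ) : x * y ≤ (x + y) ^ 2 / 4 := by
  rw [Nat.le_div_iff_mul_le (by norm_num)]
  have h := sq_nonneg ((x : ℤ) - y)
  have : (x * y * 4 : ℤ) ≤ (x + y) ^ 2 := by nlinarith
  exact_mod_cast this

theorem sq_div_four_mono {a b : ℕ} (h : a ≤ b) : a ^ 2 / 4 ≤ b ^ 2 / 4 :=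
  Nat.div_le_div_right (Nat.pow_le_pow_left h 2)

theorem sq_div_four_strictMono {a b : ℕ} (h1 : 1 ≤ a) (h : a < b) : a ^ 2 / 4 < b ^ 2 / 4 := by
  refine lt_of_lt_of_le ?_ (sq_div_four_mono (Nat.succ_le_of_lt h))
  rcases Nat.even_or_odd' a with ⟨p, rfl | rfl⟩
  · rw [Nat.succ_eq_add_one, even_sq_div_four, odd_sq_div_four]
    nlinarith
  · rw [Nat.succ_eq_add_one, show 2 * p + 1 + 1 = 2 * (p + 1) by ring, even_sq_div_four,
      odd_sq_div_four]
    nlinarith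

/-- Two numbers with the largest possible product for their sum are balanced. -/
theorem balanced_of_mul_eq {x y n : ℕ} (h : x * y = n ^ 2 / 4) (hn : x + y = n) :
    (x = n / 2 ∧ y = (n + 1) / 2) ∨ (y = n / 2 ∧ x = (n + 1) / 2) := by
  wlog hxy : x ≤ y generalizing x y
  · exact (this (by rwa [mul_comm]) (by omega) (by omega)).symm
  refine Or.inl ?_
  suffices y ≤ x + 1 by omega
  by_contra hlt
  obtain ⟨d, rfl⟩ := Nat.exists_eq_add_of_le (show x + 2 ≤ y by omega)
  have h1 := mul_le_sq_div_four (x + 1) (x + 1 + d)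
  rw [show x + 1 + (x + 1 + d) = n by omega] at h1
  nlinarith

theorem degProd_le {V : Type*} {T : SimpleGraph V} (e : Sym2 V) :
    degProd T e ≤ degSum T e ^ 2 / 4 := by
  induction e with
  | _ v w => exact mul_le_sq_div_four _ _

section

variable {V : Type*} [Fintype V] {T : SimpleGraph V} {M : Finset (Sym2 V)}

theorem three_le_degSum (hT : T.IsTree) (h3 : 3 ≤ Fintype.card V) (hM : M ∈ matchings T)
    {e : Sym2 V} (he : e ∈ M) : 3 ≤ degSum T e := by
  induction e with
  | _ v w => exact three_le_deg_add_deg hT (by rwa [Nat.card_eq_fintype_card]) (adj_of_mem hM he)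

theorem sum_degSum_sub_two (hT : T.IsTree) (h3 : 3 ≤ Fintype.card V) (hM : M ∈ matchings T) :
    ∑ e ∈ M, (degSum T e - 2) + ∑ v ∈ missed M, deg T v + 2 =
      Fintype.card V + (missed M).card := by
  have h1 := sum_degSum_add hT hM
  have h2 := card_missed hM
  have h4 : ∑ e ∈ M, (degSum T e - 2) + ∑ e ∈ M, 2 = ∑ e ∈ M, degSum T e := by
    rw [← Finset.sum_add_distrib]
    refine Finset.sum_congr rfl fun e he => ?_
    have := three_le_degSum hT h3 hM he
    omega
  simp at h4
  omega

theorem sum_degProd_lt (hT : T.IsTree) (h6 : 6 ≤ Fintype.card V)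
    (hne : ∀ v w, T.Adj v w → deg T v = Fintype.card V / 2 → deg T w ≠ (Fintype.card V + 1) / 2)
    (hM : M ∈ matchings T) : ∑ e ∈ M, degProd T e < Fintype.card V ^ 2 / 4 := by
  set n := Fintype.card V with hn
  have h9 : 9 ≤ n ^ 2 / 4 := sq_div_four_mono h6
  have h3 : ∀ e ∈ M, 3 ≤ degSum T e := fun e he => three_le_degSum hT (by omega) hM he
  have hle : ∑ e ∈ M, degProd T e ≤ ∑ e ∈ M, (degSum T e - 2 + 2) ^ 2 / 4 :=
    Finset.sum_le_sum fun e he => by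
      rw [Nat.sub_add_cancel (by have := h3 e he; omega)]
      exact degProd_le e
  have hsum : ∑ e ∈ M, (degSum T e - 2) + 2 ≤ n := by
    have h1 := sum_degSum_sub_two hT (by omega) hM
    have h2 := card_missed_le_sum_deg (M := M) hT (by omega)
    omega
  rcases M.eq_empty_or_nonempty with rfl | ⟨e, he⟩
  · simp only [Finset.sum_empty]; omega
  rcases (M.erase e).eq_empty_or_nonempty with hE | hE
  · obtain rfl : M = {e} := by
      rw [Finset.erase_eq_empty_iff] at hE
      rcases hE with rfl | h
      · simp at he
      · exact h
    rw [Finset.sum_singleton] at *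
    have h3 := h3 e he
    rcases (show degSum T e < n ∨ degSum T e = n by omega) with h | h
    · exact (degProd_le e).trans_lt (sq_div_four_strictMono (by omega) h)
    · refine lt_of_le_of_ne (h ▸ degProd_le e) fun heq => ?_
      induction e with
      | _ v w =>
        have hadj := adj_of_mem hM he
        rcases balanced_of_mul_eq heq h with ⟨h1, h2⟩ | ⟨h1, h2⟩
        · exact hne v w hadj h1 h2
        · exact hne w v hadj.symm h1 h2
  · obtain ⟨h1, h2⟩ := sum_sq_div_four_le (M.erase e) hE (fun e => degSum T e - 2) (by
      intro e he
      have := h3 e (Finset.mem_of_mem_erase he)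
      omega)
    have h4 := sq_div_four_add_le (a := degSum T e - 2) (by have := h3 e he; omega) h1
    rw [← Finset.add_sum_erase _ (fun e => (degSum T e - 2 + 2) ^ 2 / 4) he] at hle
    rw [← Finset.add_sum_erase _ _ he] at hsum
    set t := degSum T e - 2
    set r := ∑ e ∈ M.erase e, (degSum T e - 2)
    have h5 : (t + r + 2) ^ 2 / 4 ≤ n ^ 2 / 4 := sq_div_four_mono hsum
    by_cases h6 : 4 ≤ t + r
    · rw [if_pos h6] at h4
      omega
    · rw [if_neg h6] at h4
      have h7 : (t + r + 2) ^ 2 / 4 ≤ 5 ^ 2 / 4 := sq_div_four_mono (by omega)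
      omega

end

theorem doubleBroom_adj_center (a b : ℕ) :
    (doubleBroom a b).Adj (.inl false) (.inl true) := by
  simp [doubleBroom, SimpleGraph.fromRel_adj]

theorem doubleBroom_isTree (a b : ℕ) : (doubleBroom a b).IsTree := by
  refine isTree_of_parent (.inl false)
    (fun v => match v with
      | .inl _ => .inl false
      | .inr (.inl _) => .inl false
      | .inr (.inr _) => .inl true)
    (fun v => match v with
      | .inl false => 0
      | .inl true => 1
      | .inr _ => 2) ?_ ?_ ?_
  · rintro ((_ | _) | (_ | _)) h <;> simp_all [doubleBroom, SimpleGraph.fromRel_adj]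
  · rintro ((_ | _) | (_ | _)) h <;> simp_all
  · rintro ((_ | _) | (_ | _)) ((_ | _) | (_ | _)) <;> simp [doubleBroom, SimpleGraph.fromRel_adj]

theorem card_doubleBroom {n : ℕ} (hn : 6 ≤ n) :
    Nat.card (Bool ⊕ (Fin (n / 2 - 1) ⊕ Fin ((n + 1) / 2 - 1))) = n := by
  simp
  omega

theorem le_deg_doubleBroom_false (a b : ℕ) : a + 1 ≤ deg (doubleBroom a b) (.inl false) := by
  have hsub : Set.range (fun o : Option (Fin a) => (o.elim (.inl true) fun i => .inr (.inl i) :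
      Bool ⊕ (Fin a ⊕ Fin b))) ⊆ (doubleBroom a b).neighborSet (.inl false) := by
    rintro _ ⟨_ | i, rfl⟩ <;> simp [doubleBroom, SimpleGraph.fromRel_adj]
  have h := Set.ncard_le_ncard hsub (Set.toFinite _)
  rw [← Nat.card_coe_set_eq, Nat.card_range_of_injective] at h
  · simpa [deg] using h
  · rintro (_ | i) (_ | j) <;> simp

theorem le_deg_doubleBroom_true (a b : ℕ) : b + 1 ≤ deg (doubleBroom a b) (.inl true) := by
  have hsub : Set.range (fun o : Option (Fin b) => (o.elim (.inl false) fun i => .inr (.inr i) :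
      Bool ⊕ (Fin a ⊕ Fin b))) ⊆ (doubleBroom a b).neighborSet (.inl true) := by
    rintro _ ⟨_ | i, rfl⟩ <;> simp [doubleBroom, SimpleGraph.fromRel_adj]
  have h := Set.ncard_le_ncard hsub (Set.toFinite _)
  rw [← Nat.card_coe_set_eq, Nat.card_range_of_injective] at h
  · simpa [deg] using h
  · rintro (_ | i) (_ | j) <;> simp

/-- A tree with two adjacent vertices whose degrees sum to the order is a double broom. -/
theorem nonempty_iso_doubleBroom {V : Type*} [Fintype V] {T : SimpleGraph V} (hT : T.IsTree)
    {x y : V} (h : T.Adj x y) {a b : ℕ} (hx : deg T x = a + 1) (hy : deg T y = b + 1)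
    (hcard : Fintype.card V = a + b + 2) : Nonempty (T ≃g doubleBroom a b) := by
  have key : ∀ {x y : V} {a : ℕ}, T.Adj x y → deg T x = a + 1 →
      ∃ f : Fin a → V, Function.Injective f ∧ ∀ i, T.Adj x (f i) ∧ f i ≠ y := by
    intro x y a h hx
    have h1 : (T.neighborSet x \ {y}).ncard = a := by
      rw [Set.ncard_sdiff_singleton_of_mem (show y ∈ T.neighborSet x from h)]
      unfold deg at hx
      omega
    rw [← Nat.card_coe_set_eq] at h1
    let e := Finite.equivFinOfCardEq h1
    exact ⟨fun i => (e.symm i).1, fun i j hij => e.symm.injective (Subtype.ext hij),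
      fun i => ⟨(e.symm i).2.1, (e.symm i).2.2⟩⟩
  obtain ⟨f, hf, hf'⟩ := key h hx
  obtain ⟨g, hg, hg'⟩ := key h.symm hy
  have hfg : ∀ i j, f i ≠ g j := by
    intro i j hij
    obtain ⟨v, hv, hu⟩ := exists_mem_neighbors_subsingleton hT (D := {x, y, f i})
      (Set.toFinite _) ⟨x, by simp⟩
    have h1 := (hf' i).1
    have h2 := (hg' j).1
    rw [← hij] at h2
    rcases hv with rfl | rfl | rfl
    · exact h2.ne (hu y (by simp) (f i) (by simp) h h1)
    · exact h1.ne (hu x (by simp) (f i) (by simp) h.symm h2)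
    · exact h.ne (hu x (by simp) y (by simp) h1.symm h2.symm)
  obtain ⟨F⟩ := nonempty_iso_of_injective_hom (doubleBroom_isTree a b) hT
    (by simp [hcard]; omega)
    (fun v => match v with
      | .inl false => x
      | .inl true => y
      | .inr (.inl i) => f i
      | .inr (.inr j) => g j) (by
      have h1 := fun i => (hf' i).1.ne
      have h2 := fun i => (hf' i).2
      have h3 := fun i => (hg' i).1.ne
      have h4 := fun i => (hg' i).2
      have h5 := h.ne
      rintro ((_ | _) | (i | i)) ((_ | _) | (j | j)) hij <;> simp only at hij
      · rfl
      · exact absurd hij h5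
      · exact absurd hij (h1 _)
      · exact absurd hij.symm (h4 _)
      · exact absurd hij.symm h5
      · rfl
      · exact absurd hij.symm (h2 _)
      · exact absurd hij (h3 _)
      · exact absurd hij.symm (h1 _)
      · exact absurd hij (h2 _)
      · rw [hf hij]
      · exact absurd hij (hfg _ _)
      · exact absurd hij (h4 _)
      · exact absurd hij.symm (h3 _)
      · exact absurd hij.symm (hfg _ _)
      · rw [hg hij]) (by
      have h1 := fun i => (hf' i).1
      have h2 := fun i => (hg' i).1
      have h3 := fun i => (hf' i).1.symm
      have h4 := fun i => (hg' i).1.symm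
      have h5 := h.symm
      rintro ((_ | _) | (i | i)) ((_ | _) | (j | j)) <;>
        simp [doubleBroom, SimpleGraph.fromRel_adj, *])
  exact ⟨F.symm⟩

theorem phi2_maximizer (n : ℕ) (hn : 6 ≤ n) : ∀ᶠ c : ℝ in Filter.atTop,
    IsUniqueMaximizer.{u, 0} (phi2 c) n (doubleBroom (n / 2 - 1) ((n + 1) / 2 - 1)) := by
  filter_upwards [Filter.eventually_ge_atTop (((2 ^ n : ℕ) : ℝ) + 1)] with c hc
  have hc1 : 1 ≤ c := by have := Nat.cast_nonneg (α := ℝ) (2 ^ n); linarith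
  have hc0 : 0 ≤ c := by linarith
  refine isUniqueMaximizer_of_lt (doubleBroom_isTree _ _) (card_doubleBroom hn)
    fun U _ T hT hU hiso => ?_
  have h9 : 9 ≤ n ^ 2 / 4 := sq_div_four_mono hn
  calc Z (phi2 c) T < c ^ (n ^ 2 / 4) := by
        rw [Z_phi2]
        refine sum_lt_of_forall (hU ▸ card_matchF_le hT) (pow_nonneg hc0 (n ^ 2 / 4 - 1))
          (fun M hM => ?_) ?_
        · refine pow_le_pow_right₀ hc1 (Nat.le_sub_one_of_lt ?_)
          rw [← hU]
          refine sum_degProd_lt hT (by omega) (fun v w hvw hv hw => ?_) (mem_matchF.1 hM)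
          exact hiso.false (nonempty_iso_doubleBroom hT hvw (by omega) (by omega) (by omega)).some
        · have := mul_pow_lt_pow_succ hc (n ^ 2 / 4 - 1)
          rwa [Nat.sub_add_cancel (by omega)] at this
    _ ≤ Z (phi2 c) (doubleBroom (n / 2 - 1) ((n + 1) / 2 - 1)) := by
        rw [Z_phi2]
        set G := doubleBroom (n / 2 - 1) ((n + 1) / 2 - 1)
        have hM : {s(.inl false, .inl true)} ∈ matchings G := by
          refine ⟨?_, ?_⟩
          · simpa using doubleBroom_adj_center _ _
          · intro e he f hf hne
            simp only [Finset.mem_singleton] at he hf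
            exact absurd (he.trans hf.symm) hne
        refine le_trans ?_ (Finset.single_le_sum (f := fun M => c ^ (∑ e ∈ M, degProd G e))
          (fun M _ => pow_nonneg hc0 _) (mem_matchF.2 hM))
        refine pow_le_pow_right₀ hc1 ?_
        rw [Finset.sum_singleton, degProd_mk, sq_div_four]
        refine Nat.mul_le_mul ?_ ?_
        · exact le_trans (by omega) (le_deg_doubleBroom_false _ _)
        · exact le_trans (by omega) (le_deg_doubleBroom_true _ _)

end PhiTwo

/-! ## The weight `(i + j) ^ c` -/

section PhiThree

section SymmDiff

variable {V : Type*} [Finite V] {T : SimpleGraph V} {M M' : Finset (Sym2 V)}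

theorem symmDiff_closed (hM : M ∈ matchings T) (hM' : M' ∈ matchings T)
    (h4 : ∀ e ∈ M, degSum T e ≤ 4) (h4' : ∀ e ∈ M', degSum T e ≤ 4)
    (hm' : ∀ v, v ∉ cov M' → deg T v = 1)
    (htw : ∀ v w x, w ≠ x → deg T w = 1 → deg T x = 1 → s(v, w) ∈ M → s(v, x) ∈ M' →
      w ∉ cov M' → x ∈ cov M)
    {v w : V} (hw : s(v, w) ∈ M) (hw' : s(v, w) ∉ M') :
    deg T v ≤ 2 ∧ ∀ y, T.Adj v y →
      ∃ z, (s(y, z) ∈ M ∧ s(y, z) ∉ M') ∨ (s(y, z) ∈ M' ∧ s(y, z) ∉ M) := by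
  have hvw := adj_of_mem hM hw
  have hwD : ∃ z, (s(w, z) ∈ M ∧ s(w, z) ∉ M') ∨ (s(w, z) ∈ M' ∧ s(w, z) ∉ M) :=
    ⟨v, Or.inl (by rw [Sym2.eq_swap]; exact ⟨hw, hw'⟩)⟩
  by_cases hv : v ∈ cov M'
  · obtain ⟨x, hx⟩ := mem_cov.1 hv
    have hwx : w ≠ x := fun h => hw' (h ▸ hx)
    have hvx := adj_of_mem hM' hx
    have hx' : s(v, x) ∉ M := fun h => hwx (eq_of_mem hM hw h)
    have hdv := two_le_deg hvw hvx hwx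
    have hdeg : deg T v = 2 := by
      have e1 := h4 _ hw
      have e2 := h4' _ hx
      rw [degSum_mk] at e1 e2
      suffices 2 ≤ deg T w ∨ 2 ≤ deg T x by omega
      by_cases hwc : w ∈ cov M'
      · obtain ⟨y, hy⟩ := mem_cov.1 hwc
        refine Or.inl (two_le_deg hvw.symm (adj_of_mem hM' hy) ?_)
        rintro rfl
        exact hw' (by rwa [Sym2.eq_swap])
      · right
        by_contra hlt
        have h1 := one_le_deg_of_adj hvx.symm
        have hxc := htw v w x hwx (hm' w hwc) (by omega) hw hx hwc
        obtain ⟨y, hy⟩ := mem_cov.1 hxc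
        refine hlt (two_le_deg hvx.symm (adj_of_mem hM hy) ?_)
        rintro rfl
        exact hx' (by rwa [Sym2.eq_swap])
    refine ⟨hdeg.le, fun y hy => ?_⟩
    rcases eq_or_eq_of_deg_eq_two hdeg hvw hvx hwx hy with rfl | rfl
    · exact hwD
    · exact ⟨v, Or.inr (by rw [Sym2.eq_swap]; exact ⟨hx, hx'⟩)⟩
  · have h1 := hm' v hv
    refine ⟨by omega, fun y hy => ?_⟩
    rw [eq_of_deg_eq_one h1 hy hvw]
    exact hwD

/-- Two distinct matchings of a tree which miss only leaves, and whose edges have degree sums at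
most four, exist only in a path or at two leaves with a common neighbour. -/
theorem deg_le_two_or_twins (hT : T.IsTree) (hM : M ∈ matchings T) (hM' : M' ∈ matchings T)
    (hne : M ≠ M') (h4 : ∀ e ∈ M, degSum T e ≤ 4) (h4' : ∀ e ∈ M', degSum T e ≤ 4)
    (hm : ∀ v, v ∉ cov M → deg T v = 1) (hm' : ∀ v, v ∉ cov M' → deg T v = 1) :
    (∀ v, deg T v ≤ 2) ∨ ∃ v w x, w ≠ x ∧ deg T w = 1 ∧ deg T x = 1 ∧ s(v, w) ∈ M ∧
      s(v, x) ∈ M' ∧ w ∉ cov M' ∧ x ∉ cov M := by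
  by_cases htw : ∃ v w x, w ≠ x ∧ deg T w = 1 ∧ deg T x = 1 ∧ s(v, w) ∈ M ∧
      s(v, x) ∈ M' ∧ w ∉ cov M' ∧ x ∉ cov M
  · exact Or.inr htw
  push Not at htw
  refine Or.inl ?_
  let D : Set V := {v | ∃ w, (s(v, w) ∈ M ∧ s(v, w) ∉ M') ∨ (s(v, w) ∈ M' ∧ s(v, w) ∉ M)}
  have hD : D.Nonempty := by
    have : ∃ e, (e ∈ M ∧ e ∉ M') ∨ (e ∈ M' ∧ e ∉ M) := by
      by_contra! h
      exact hne (Finset.ext fun e => ⟨fun h1 => (h e).1 h1, fun h1 => (h e).2 h1⟩)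
    obtain ⟨e, he⟩ := this
    induction e with
    | _ v w => exact ⟨v, w, he⟩
  have key : ∀ v ∈ D, deg T v ≤ 2 ∧ ∀ y, T.Adj v y → y ∈ D := by
    rintro v ⟨w, ⟨h1, h2⟩ | ⟨h1, h2⟩⟩
    · exact symmDiff_closed hM hM' h4 h4' hm' htw h1 h2
    · have := symmDiff_closed hM' hM h4' h4 hm (fun v w x hwx hw hx h1 h2 h3 => by
        by_contra h5
        exact h3 (htw v x w hwx.symm hx hw h2 h1 h5)) h1 h2
      refine ⟨this.1, fun y hy => ?_⟩
      obtain ⟨z, hz⟩ := this.2 y hy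
      exact ⟨z, hz.symm⟩
  intro v
  exact (key v (eq_univ_of_adj_closed hT.connected hD (fun v hv => (key v hv).2) v)).1

end SymmDiff

section Bound

theorem natCast_le_geom (t : ℕ) : ((t + 2 : ℕ) : ℝ) ≤ 9 / 4 * (4 / 3) ^ t := by
  induction t with
  | zero => norm_num
  | succ t ih =>
    rcases Nat.lt_or_ge t 2 with h | h
    · interval_cases t <;> norm_num
    · rw [pow_succ, ← mul_assoc]
      push_cast at *
      have : (2 : ℝ) ≤ t := by exact_mod_cast h
      linarith

theorem natCast_lt_geom {t : ℕ} (h : 3 ≤ t) : ((t + 2 : ℕ) : ℝ) < 9 / 4 * (4 / 3) ^ t := by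
  obtain ⟨t, rfl⟩ := Nat.exists_eq_add_of_le' (show 1 ≤ t by omega)
  have h1 := natCast_le_geom t
  rw [pow_succ, ← mul_assoc]
  push_cast at *
  have : (2 : ℝ) ≤ t := by
    have : 2 ≤ t := by omega
    exact_mod_cast this
  linarith

theorem natCast_eq_geom {t : ℕ} (h : t = 1 ∨ t = 2) :
    ((t + 2 : ℕ) : ℝ) = 9 / 4 * (4 / 3) ^ t := by
  rcases h with rfl | rfl <;> norm_num

theorem geom_prod {ι : Type*} (s : Finset ι) (t : ι → ℕ) :
    ∏ e ∈ s, (9 / 4 * (4 / 3) ^ t e : ℝ) = (9 / 4) ^ s.card * (4 / 3) ^ ∑ e ∈ s, t e := by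
  rw [Finset.prod_mul_distrib, Finset.prod_const, Finset.prod_pow_eq_pow_sum]

theorem geom_balanced (i j m : ℕ) :
    (9 / 4 : ℝ) ^ (j + i) * (4 / 3) ^ (2 * j + m) = (9 / 4) ^ i * (4 / 3) ^ m * 4 ^ j := by
  have : (9 / 4 : ℝ) ^ j * (4 / 3) ^ (2 * j) = 4 ^ j := by
    rw [pow_mul, ← mul_pow]
    norm_num
  rw [← this, pow_add, pow_add]
  ring

variable {V : Type*} [Fintype V] {T : SimpleGraph V} {M : Finset (Sym2 V)}

theorem prod_degSum_eq (hT : T.IsTree) (h3 : 3 ≤ Fintype.card V) (hM : M ∈ matchings T)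
    (h4 : ∀ e ∈ M, degSum T e ≤ 4) : ((∏ e ∈ M, degSum T e : ℕ) : ℝ) =
      (9 / 4) ^ M.card * (4 / 3) ^ ∑ e ∈ M, (degSum T e - 2) := by
  rw [← geom_prod, Nat.cast_prod]
  refine Finset.prod_congr rfl fun e he => ?_
  have h5 := three_le_degSum hT h3 hM he
  have h6 := h4 e he
  rw [← natCast_eq_geom (by omega), Nat.sub_add_cancel (by omega)]

theorem prod_degSum_le (hT : T.IsTree) (h3 : 3 ≤ Fintype.card V) (hM : M ∈ matchings T) :
    ((∏ e ∈ M, degSum T e : ℕ) : ℝ) ≤ (9 / 4) ^ M.card * (4 / 3) ^ (Fintype.card V - 2) := by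
  have h1 := sum_degSum_sub_two hT h3 hM
  have h2 := card_missed_le_sum_deg (M := M) hT (by omega)
  calc ((∏ e ∈ M, degSum T e : ℕ) : ℝ) ≤ ∏ e ∈ M, (9 / 4 * (4 / 3) ^ (degSum T e - 2) : ℝ) := by
        rw [Nat.cast_prod]
        refine Finset.prod_le_prod (fun _ _ => Nat.cast_nonneg _) fun e he => ?_
        have h := natCast_le_geom (degSum T e - 2)
        rwa [Nat.sub_add_cancel (by have := three_le_degSum hT h3 hM he; omega)] at h
    _ = (9 / 4) ^ M.card * (4 / 3) ^ ∑ e ∈ M, (degSum T e - 2) := geom_prod _ _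
    _ ≤ _ := by
        gcongr
        · norm_num
        · omega

theorem of_prod_degSum_ge (hT : T.IsTree) (h3 : 3 ≤ Fintype.card V) (hM : M ∈ matchings T)
    (h : (9 / 4) ^ M.card * (4 / 3) ^ (Fintype.card V - 2) ≤ ((∏ e ∈ M, degSum T e : ℕ) : ℝ)) :
    (∀ e ∈ M, degSum T e ≤ 4) ∧ ∀ v, v ∉ cov M → deg T v = 1 := by
  have h1 := sum_degSum_sub_two hT h3 hM
  have h2 := card_missed_le_sum_deg (M := M) hT (by omega)
  have h5 : (9 / 4 : ℝ) ^ M.card * (4 / 3) ^ ∑ e ∈ M, (degSum T e - 2) ≤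
      (9 / 4) ^ M.card * (4 / 3) ^ (Fintype.card V - 2) := by
    gcongr
    · norm_num
    · omega
  have h4 : ∀ e ∈ M, degSum T e ≤ 4 := by
    by_contra! hlt
    obtain ⟨e, he, hlt⟩ := hlt
    have : ((∏ e ∈ M, degSum T e : ℕ) : ℝ) < ∏ e ∈ M, (9 / 4 * (4 / 3) ^ (degSum T e - 2) : ℝ) := by
      rw [Nat.cast_prod]
      refine Finset.prod_lt_prod (fun e he => ?_) (fun e he => ?_) ⟨e, he, ?_⟩
      · have := three_le_degSum hT h3 hM he
        exact_mod_cast (show 0 < degSum T e by omega)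
      · have h := natCast_le_geom (degSum T e - 2)
        rwa [Nat.sub_add_cancel (by have := three_le_degSum hT h3 hM he; omega)] at h
      · have h := natCast_lt_geom (t := degSum T e - 2) (by omega)
        rwa [Nat.sub_add_cancel (by omega)] at h
    rw [geom_prod] at this
    linarith
  refine ⟨h4, fun v hv => deg_eq_one_of_sum_missed hT (by omega) ?_ hv⟩
  rw [prod_degSum_eq hT h3 hM h4] at h
  have h6 := le_of_mul_le_mul_left h (by positivity)
  rw [pow_le_pow_iff_right₀ (by norm_num)] at h6
  omega

theorem geom_card_mono {i j : ℕ} (h : i ≤ j) (m : ℕ) :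
    (9 / 4 : ℝ) ^ i * (4 / 3) ^ m ≤ (9 / 4) ^ j * (4 / 3) ^ m := by
  gcongr
  norm_num

end Bound

section PathValues

variable {n : ℕ} {I : ℕ → Prop}

theorem prod_degSum_pathEdges (hn : 3 ≤ n) (hI : ∀ i, I i → ¬ I (i + 1)) {k m d : ℕ}
    (hk : 2 * k + (missed (pathEdges n I)).card = n)
    (hm : (missed (pathEdges n I)).card = m)
    (hd : ∑ v ∈ missed (pathEdges n I), deg (SimpleGraph.pathGraph n) v = m + d) :
    ((∏ e ∈ pathEdges n I, degSum (SimpleGraph.pathGraph n) e : ℕ) : ℝ) =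
      (9 / 4) ^ k * (4 / 3) ^ (n - 2 - d) := by
  have hM := pathEdges_mem_matchings hI (n := n)
  have hT := pathGraph_isTree (n := n) (by omega)
  have h1 := sum_degSum_sub_two hT (by simpa) hM
  have h2 := card_missed hM
  rw [Fintype.card_fin] at h1 h2
  rw [prod_degSum_eq hT (by simpa) hM]
  · congr 2 <;> omega
  · intro e _
    induction e with
    | _ v w =>
      have h1 := deg_pathGraph_le v
      have h2 := deg_pathGraph_le w
      rw [degSum_mk]
      omega

theorem missed_even_evenEdges (hn : n % 2 = 0) :
    missed (pathEdges n fun i => i % 2 = 0) = ∅ := by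
  ext v
  simp only [mem_missed, mem_cov_pathEdges, Finset.notMem_empty, iff_false, not_not]
  rcases Nat.mod_two_eq_zero_or_one v.1 with h | h
  · exact Or.inl ⟨h, by omega⟩
  · exact Or.inr ⟨v.1 - 1, by omega, by omega⟩

theorem missed_even_oddEdges (hn : n % 2 = 0) (h2 : 2 ≤ n) :
    missed (pathEdges n fun i => i % 2 = 1) = {⟨0, by omega⟩, ⟨n - 1, by omega⟩} := by
  ext v
  simp only [mem_missed, mem_cov_pathEdges, Finset.mem_insert, Finset.mem_singleton, Fin.ext_iff]
  have := v.2
  constructor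
  · intro h
    by_contra h'
    refine h ?_
    rcases Nat.mod_two_eq_zero_or_one v.1 with h | h
    · exact Or.inr ⟨v.1 - 1, by omega, by omega⟩
    · exact Or.inl ⟨h, by omega⟩
  · rintro h (h1 | ⟨i, h1⟩) <;> omega

/-- The matching of the path that misses only the vertex `2 * m`. -/
theorem missed_odd {m : ℕ} (hn : n % 2 = 1) (hm : 2 * m < n) :
    missed (pathEdges n fun i => (i % 2 = 0 ∧ i < 2 * m) ∨ (i % 2 = 1 ∧ 2 * m < i)) =
      {⟨2 * m, hm⟩} := by
  ext v
  simp only [mem_missed, mem_cov_pathEdges, Finset.mem_singleton, Fin.ext_iff]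
  have := v.2
  constructor
  · intro h
    by_contra h'
    refine h ?_
    by_cases h1 : (v.1 % 2 = 0 ∧ v.1 < 2 * m) ∨ (v.1 % 2 = 1 ∧ 2 * m < v.1)
    · exact Or.inl ⟨h1, by omega⟩
    · exact Or.inr ⟨v.1 - 1, by omega, by omega⟩
  · rintro h (h1 | ⟨i, h1⟩) <;> omega

theorem val_evenEdges (j : ℕ) :
    ∏ e ∈ pathEdges (2 * j + 4) (fun i => i % 2 = 0), degSum (SimpleGraph.pathGraph (2 * j + 4)) e =
      9 * 4 ^ j := by
  have hms := missed_even_evenEdges (n := 2 * j + 4) (by omega)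
  have h := prod_degSum_pathEdges (n := 2 * j + 4) (I := fun i => i % 2 = 0) (by omega) (by omega)
    (k := j + 2) (m := 0) (d := 0) (by rw [hms]; simp; omega) (by rw [hms]; simp)
    (by rw [hms]; simp)
  rw [show 2 * j + 4 - 2 - 0 = 2 * j + 2 by omega, geom_balanced] at h
  have h2 : (9 / 4 : ℝ) ^ 2 * (4 / 3) ^ 2 * 4 ^ j = ((9 * 4 ^ j : ℕ) : ℝ) := by
    push_cast; ring
  exact_mod_cast h.trans h2

theorem val_oddEdges (j : ℕ) :
    ∏ e ∈ pathEdges (2 * j + 4) (fun i => i % 2 = 1), degSum (SimpleGraph.pathGraph (2 * j + 4)) e =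
      4 ^ (j + 1) := by
  have hms := missed_even_oddEdges (n := 2 * j + 4) (by omega) (by omega)
  have hcard : (missed (pathEdges (2 * j + 4) fun i => i % 2 = 1)).card = 2 := by
    rw [hms, Finset.card_pair (by simp [Fin.ext_iff])]
  have h := prod_degSum_pathEdges (n := 2 * j + 4) (I := fun i => i % 2 = 1) (by omega) (by omega)
    (k := j + 1) (m := 2) (d := 0) (by rw [hcard]; omega) hcard (by
      rw [hms, Finset.sum_pair (by simp [Fin.ext_iff]), deg_pathGraph_end (by omega) _ (by simp),
        deg_pathGraph_end (by omega) _ (by simp)])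
  rw [show 2 * j + 4 - 2 - 0 = 2 * j + 2 by omega, geom_balanced] at h
  have h2 : (9 / 4 : ℝ) ^ 1 * (4 / 3) ^ 2 * 4 ^ j = ((4 ^ (j + 1) : ℕ) : ℝ) := by
    push_cast; ring
  exact_mod_cast h.trans h2

/-- The matching of a path of odd order that misses only the vertex `2 * m`. -/
noncomputable def pathMissing (n m : ℕ) : Finset (Sym2 (Fin n)) :=
  pathEdges n fun i => (i % 2 = 0 ∧ i < 2 * m) ∨ (i % 2 = 1 ∧ 2 * m < i)

theorem pathMissing_mem (n m : ℕ) : pathMissing n m ∈ matchings (SimpleGraph.pathGraph n) :=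
  pathEdges_mem_matchings (by omega)

theorem val_pathMissing (j m d : ℕ) (hm : 2 * m < 2 * j + 5) (hd' : d ≤ 1)
    (hd : deg (SimpleGraph.pathGraph (2 * j + 5)) ⟨2 * m, hm⟩ = 1 + d) :
    ((∏ e ∈ pathMissing (2 * j + 5) m, degSum (SimpleGraph.pathGraph (2 * j + 5)) e : ℕ) : ℝ) =
      (9 / 4) ^ 2 * (4 / 3) ^ (3 - d) * 4 ^ j := by
  have hms := missed_odd (n := 2 * j + 5) (by omega) hm
  have h := prod_degSum_pathEdges (n := 2 * j + 5)
    (I := fun i => (i % 2 = 0 ∧ i < 2 * m) ∨ (i % 2 = 1 ∧ 2 * m < i)) (by omega) (by omega)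
    (k := j + 2) (m := 1) (d := d) (by rw [hms]; simp; omega) (by rw [hms]; simp)
    (by rw [hms, Finset.sum_singleton, hd])
  rw [show 2 * j + 5 - 2 - d = 2 * j + (3 - d) by omega, geom_balanced] at h
  exact h

theorem val_pathMissing_end (j m : ℕ) (hm : m = 0 ∨ m = j + 2) :
    ∏ e ∈ pathMissing (2 * j + 5) m, degSum (SimpleGraph.pathGraph (2 * j + 5)) e =
      12 * 4 ^ j := by
  have h := val_pathMissing j m 0 (by omega) (by omega)
    (deg_pathGraph_end (by omega) _ (by simp only; omega))
  have h2 : (9 / 4 : ℝ) ^ 2 * (4 / 3) ^ 3 * 4 ^ j = ((12 * 4 ^ j : ℕ) : ℝ) := by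
    push_cast; ring
  exact_mod_cast h.trans h2

theorem val_pathMissing_one (j : ℕ) :
    ∏ e ∈ pathMissing (2 * j + 5) 1, degSum (SimpleGraph.pathGraph (2 * j + 5)) e =
      9 * 4 ^ j := by
  have h := val_pathMissing j 1 1 (by omega) (by omega)
    (deg_pathGraph_inner _ (by simp) (by simp only; omega))
  have h2 : (9 / 4 : ℝ) ^ 2 * (4 / 3) ^ 2 * 4 ^ j = ((9 * 4 ^ j : ℕ) : ℝ) := by
    push_cast; ring
  exact_mod_cast h.trans h2

theorem pathMissing_ne (j : ℕ) {m m' : ℕ} (hm : 2 * m < 2 * j + 5) (hm' : 2 * m' < 2 * j + 5)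
    (h : m ≠ m') : pathMissing (2 * j + 5) m ≠ pathMissing (2 * j + 5) m' := by
  intro heq
  have h1 := missed_odd (n := 2 * j + 5) (by omega) hm
  have h2 := missed_odd (n := 2 * j + 5) (by omega) hm'
  have h3 := congrArg missed heq
  rw [pathMissing, pathMissing, h1, h2, Finset.singleton_inj, Fin.mk.injEq] at h3
  omega

theorem le_Z_phi3_path_even (j : ℕ) (c : ℝ) :
    ((9 * 4 ^ j : ℕ) : ℝ) ^ c + ((4 ^ (j + 1) : ℕ) : ℝ) ^ c ≤
      Z (phi3 c) (SimpleGraph.pathGraph (2 * j + 4)) := by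
  rw [Z_phi3, ← val_evenEdges, ← val_oddEdges]
  have hne : pathEdges (2 * j + 4) (fun i => i % 2 = 0) ≠ pathEdges _ (fun i => i % 2 = 1) := by
    intro h
    have h1 := congrArg missed h
    rw [missed_even_evenEdges (by omega), missed_even_oddEdges (by omega) (by omega)] at h1
    exact (Finset.insert_ne_empty _ _ h1.symm)
  rw [← Finset.sum_pair (f := fun M => ((∏ e ∈ M, degSum (SimpleGraph.pathGraph (2 * j + 4)) e : ℕ) :
    ℝ) ^ c) hne]
  refine Finset.sum_le_sum_of_subset_of_nonneg ?_ fun M _ _ => Real.rpow_nonneg (Nat.cast_nonneg _) c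
  simp only [Finset.insert_subset_iff, Finset.singleton_subset_iff, mem_matchF]
  exact ⟨pathEdges_mem_matchings (by omega), pathEdges_mem_matchings (by omega)⟩

theorem le_Z_phi3_path_odd (j : ℕ) (c : ℝ) :
    2 * ((12 * 4 ^ j : ℕ) : ℝ) ^ c + ((9 * 4 ^ j : ℕ) : ℝ) ^ c ≤
      Z (phi3 c) (SimpleGraph.pathGraph (2 * j + 5)) := by
  rw [Z_phi3]
  have h1 := pathMissing_ne j (m := 0) (m' := j + 2) (by omega) (by omega) (by omega)
  have h2 := pathMissing_ne j (m := 0) (m' := 1) (by omega) (by omega) (by omega)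
  have h3 := pathMissing_ne j (m := j + 2) (m' := 1) (by omega) (by omega) (by omega)
  have h : ∑ M ∈ {pathMissing (2 * j + 5) 0, pathMissing (2 * j + 5) (j + 2),
      pathMissing (2 * j + 5) 1},
      ((∏ e ∈ M, degSum (SimpleGraph.pathGraph (2 * j + 5)) e : ℕ) : ℝ) ^ c =
      2 * ((12 * 4 ^ j : ℕ) : ℝ) ^ c + ((9 * 4 ^ j : ℕ) : ℝ) ^ c := by
    rw [Finset.sum_insert (by simp [h1, h2]), Finset.sum_pair h3, val_pathMissing_end j 0 (by simp),
      val_pathMissing_end j (j + 2) (by simp), val_pathMissing_one]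
    ring
  rw [← h]
  refine Finset.sum_le_sum_of_subset_of_nonneg ?_ fun M _ _ => Real.rpow_nonneg (Nat.cast_nonneg _) c
  simp only [Finset.insert_subset_iff, Finset.singleton_subset_iff, mem_matchF]
  exact ⟨pathMissing_mem _ _, pathMissing_mem _ _, pathMissing_mem _ _⟩

end PathValues

section Comparison

variable {V : Type*} [Fintype V] {T : SimpleGraph V} {M M' : Finset (Sym2 V)} {j : ℕ}

theorem rpow_le_pred {m K : ℕ} {c : ℝ} (hc : 0 ≤ c) (h : m < K) :
    (m : ℝ) ^ c ≤ ((K - 1 : ℕ) : ℝ) ^ c :=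
  Real.rpow_le_rpow (Nat.cast_nonneg _) (by exact_mod_cast Nat.le_sub_one_of_lt h) hc

theorem val_le_perfect (hT : T.IsTree) (hV : Fintype.card V = 2 * j + 4) (hM : M ∈ matchings T) :
    ∏ e ∈ M, degSum T e ≤ 9 * 4 ^ j := by
  have h1 := prod_degSum_le hT (by omega) hM
  have h2 := card_missed hM
  have h3 := h1.trans (geom_card_mono (show M.card ≤ j + 2 by omega) _)
  rw [hV, show 2 * j + 4 - 2 = 2 * j + 2 by omega, geom_balanced] at h3
  have h4 : (9 / 4 : ℝ) ^ 2 * (4 / 3) ^ 2 * 4 ^ j = ((9 * 4 ^ j : ℕ) : ℝ) := by push_cast; ring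
  exact_mod_cast h3.trans h4.le

theorem val_le_of_card_le (hT : T.IsTree) (hV : Fintype.card V = 2 * j + 4) (hM : M ∈ matchings T)
    (hcard : M.card ≤ j + 1) : ∏ e ∈ M, degSum T e ≤ 4 ^ (j + 1) := by
  have h1 := prod_degSum_le hT (by omega) hM
  have h3 := h1.trans (geom_card_mono hcard _)
  rw [hV, show 2 * j + 4 - 2 = 2 * j + 2 by omega, geom_balanced] at h3
  have h4 : (9 / 4 : ℝ) ^ 1 * (4 / 3) ^ 2 * 4 ^ j = ((4 ^ (j + 1) : ℕ) : ℝ) := by push_cast; ring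
  exact_mod_cast h3.trans h4.le

theorem phi3_lt_even (hT : T.IsTree) (hV : Fintype.card V = 2 * j + 4) (h3 : ∃ v, 3 ≤ deg T v)
    {c : ℝ} (hc : 0 ≤ c)
    (hc1 : (2 ^ (2 * j + 4) : ℕ) * ((9 * 4 ^ j - 1 : ℕ) : ℝ) ^ c < ((9 * 4 ^ j : ℕ) : ℝ) ^ c)
    (hc2 : (2 ^ (2 * j + 4) : ℕ) * ((4 ^ (j + 1) - 1 : ℕ) : ℝ) ^ c < ((4 ^ (j + 1) : ℕ) : ℝ) ^ c) :
    Z (phi3 c) T < Z (phi3 c) (SimpleGraph.pathGraph (2 * j + 4)) := by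
  refine lt_of_lt_of_le ?_ (le_Z_phi3_path_even j c)
  rw [Z_phi3]
  have hN : (matchF T).card ≤ 2 ^ (2 * j + 4) := hV ▸ card_matchF_le hT
  by_cases htop : ∃ M ∈ matchings T, ∏ e ∈ M, degSum T e = 9 * 4 ^ j
  · obtain ⟨M₀, hM₀, hval⟩ := htop
    have hlt : (4 : ℕ) ^ (j + 1) < 9 * 4 ^ j := by
      have : 0 < 4 ^ j := by positivity
      rw [pow_succ]; omega
    have hc0 : M₀.card = j + 2 := by
      have h1 := card_missed hM₀
      by_contra hne
      have := val_le_of_card_le hT hV hM₀ (by omega)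
      omega
    have hms : missed M₀ = ∅ := by
      have := card_missed hM₀
      rw [← Finset.card_eq_zero]
      omega
    have hcov : ∀ v, v ∈ cov M₀ := fun v => by
      by_contra hv
      rw [← mem_missed, hms] at hv
      simp at hv
    have hprop := of_prod_degSum_ge hT (by omega) hM₀ (by
      rw [hc0, hV, show 2 * j + 4 - 2 = 2 * j + 2 by omega, geom_balanced, hval]
      push_cast
      apply le_of_eq
      ring)
    have := sum_lt_of_exceptional (s := matchF T) (t := {M₀}) (by simpa using hM₀)
      (f := fun M => ((∏ e ∈ M, degSum T e : ℕ) : ℝ) ^ c) (m := 1)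
      (A := ((9 * 4 ^ j : ℕ) : ℝ) ^ c) hN (by simp)
      (Real.rpow_nonneg (Nat.cast_nonneg _) c) (Real.rpow_nonneg (Nat.cast_nonneg _) c)
      (by simp only [Finset.mem_singleton]; rintro M rfl; rw [hval]) (fun M hM hne => by
        refine rpow_le_pred hc (lt_of_le_of_ne ?_ fun heq => ?_) (K := 4 ^ (j + 1))
        all_goals
          rw [mem_matchF] at hM
          rw [Finset.mem_singleton] at hne
          have hcard : M.card ≤ j + 1 := by
            have h1 := card_missed hM
            by_contra hlt
            refine hne (eq_of_cov_eq hT hM hM₀ ?_)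
            have : missed M = ∅ := by rw [← Finset.card_eq_zero]; omega
            ext v
            simp only [hcov, iff_true]
            by_contra hv
            rw [← mem_missed, this] at hv
            simp at hv
        · exact val_le_of_card_le hT hV hM hcard
        · have hprop' := of_prod_degSum_ge hT (by omega) hM (by
            refine (geom_card_mono hcard _).trans ?_
            rw [hV, show 2 * j + 4 - 2 = 2 * j + 2 by omega, geom_balanced, heq]
            push_cast
            apply le_of_eq
            ring)
          rcases deg_le_two_or_twins hT hM₀ hM (Ne.symm hne) hprop.1 hprop'.1 hprop.2 hprop'.2 with
            h | ⟨v, w, x, -, -, -, -, -, -, hx⟩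
          · obtain ⟨v, hv⟩ := h3
            have := h v
            omega
          · exact hx (hcov x)) hc2
    simpa using this
  · push Not at htop
    refine (sum_lt_of_forall hN (Real.rpow_nonneg (Nat.cast_nonneg _) c) (fun M hM => ?_) hc1).trans_le
      (le_add_of_nonneg_right (Real.rpow_nonneg (Nat.cast_nonneg _) c))
    rw [mem_matchF] at hM
    exact rpow_le_pred hc (lt_of_le_of_ne (val_le_perfect hT hV hM) (htop M hM))

theorem val_le_near_perfect (hT : T.IsTree) (hV : Fintype.card V = 2 * j + 5)
    (hM : M ∈ matchings T) : ∏ e ∈ M, degSum T e ≤ 12 * 4 ^ j := by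
  have h1 := prod_degSum_le hT (by omega) hM
  have h2 := card_missed hM
  have h3 := h1.trans (geom_card_mono (show M.card ≤ j + 2 by omega) _)
  rw [hV, show 2 * j + 5 - 2 = 2 * j + 3 by omega, geom_balanced] at h3
  have h4 : (9 / 4 : ℝ) ^ 2 * (4 / 3) ^ 3 * 4 ^ j = ((12 * 4 ^ j : ℕ) : ℝ) := by push_cast; ring
  exact_mod_cast h3.trans h4.le

theorem val_lt_of_card_le (hT : T.IsTree) (hV : Fintype.card V = 2 * j + 5) (hM : M ∈ matchings T)
    (hcard : M.card ≤ j + 1) : ∏ e ∈ M, degSum T e < 9 * 4 ^ j := by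
  have h1 := prod_degSum_le hT (by omega) hM
  have h3 := h1.trans (geom_card_mono hcard _)
  rw [hV, show 2 * j + 5 - 2 = 2 * j + 3 by omega, geom_balanced] at h3
  have h4 : (9 / 4 : ℝ) ^ 1 * (4 / 3) ^ 3 * 4 ^ j < ((9 * 4 ^ j : ℕ) : ℝ) := by
    push_cast
    have : (0 : ℝ) < 4 ^ j := by positivity
    linarith
  exact_mod_cast h3.trans_lt h4

theorem eq_of_common_missed (hT : T.IsTree) {w : V} (hM : M ∈ matchings T) (hM' : M' ∈ matchings T)
    (hc : (missed M).card = 1) (hc' : (missed M').card = 1)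
    (hwM : w ∉ cov M) (hwM' : w ∉ cov M') : M = M' := by
  refine eq_of_cov_eq hT hM hM' ?_
  obtain ⟨a, ha⟩ := Finset.card_eq_one.1 hc
  obtain ⟨b, hb⟩ := Finset.card_eq_one.1 hc'
  have h1 : w = a := by rw [← mem_missed, ha] at hwM; simpa using hwM
  have h2 : w = b := by rw [← mem_missed, hb] at hwM'; simpa using hwM'
  ext u
  rw [← not_iff_not, ← mem_missed, ← mem_missed, ha, hb, ← h1, ← h2]

theorem not_mem_cov_of_twins {v w x : V} (hwx : w ≠ x) (hw : deg T w = 1) (hx : deg T x = 1)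
    (hvw : T.Adj v w) (hvx : T.Adj v x) (hM : M ∈ matchings T) : w ∉ cov M ∨ x ∉ cov M := by
  by_contra! h
  obtain ⟨a, ha⟩ := mem_cov.1 h.1
  obtain ⟨b, hb⟩ := mem_cov.1 h.2
  obtain rfl := eq_of_deg_eq_one hw (adj_of_mem hM ha) hvw.symm
  obtain rfl := eq_of_deg_eq_one hx (adj_of_mem hM hb) hvx.symm
  rw [Sym2.eq_swap] at ha hb
  exact hwx (eq_of_mem hM ha hb)

theorem phi3_lt_odd (hT : T.IsTree) (hV : Fintype.card V = 2 * j + 5) (h3 : ∃ v, 3 ≤ deg T v)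
    {c : ℝ} (hc : 0 ≤ c)
    (hc1 : (2 ^ (2 * j + 5) : ℕ) * ((12 * 4 ^ j - 1 : ℕ) : ℝ) ^ c < ((12 * 4 ^ j : ℕ) : ℝ) ^ c)
    (hc2 : (2 ^ (2 * j + 5) : ℕ) * ((9 * 4 ^ j - 1 : ℕ) : ℝ) ^ c < ((9 * 4 ^ j : ℕ) : ℝ) ^ c) :
    Z (phi3 c) T < Z (phi3 c) (SimpleGraph.pathGraph (2 * j + 5)) := by
  refine lt_of_lt_of_le ?_ (le_Z_phi3_path_odd j c)
  rw [Z_phi3]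
  have hN : (matchF T).card ≤ 2 ^ (2 * j + 5) := hV ▸ card_matchF_le hT
  have hpos : 0 < 4 ^ j := by positivity
  have h0 : ∀ m : ℕ, 0 ≤ (m : ℝ) ^ c := fun m => Real.rpow_nonneg (Nat.cast_nonneg _) c
  have hcard : ∀ M ∈ matchings T, ¬ M.card ≤ j + 1 → (missed M).card = 1 ∧ M.card = j + 2 := by
    intro M hM h
    have := card_missed hM
    omega
  have htop : ∀ M ∈ matchings T, ∏ e ∈ M, degSum T e = 12 * 4 ^ j → (missed M).card = 1 ∧
      (∀ e ∈ M, degSum T e ≤ 4) ∧ ∀ v, v ∉ cov M → deg T v = 1 := by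
    intro M hM hval
    have h1 := hcard M hM (fun h => by
      have := val_lt_of_card_le hT hV hM h
      omega)
    refine ⟨h1.1, of_prod_degSum_ge hT (by omega) hM ?_⟩
    rw [h1.2, hV, show 2 * j + 5 - 2 = 2 * j + 3 by omega, geom_balanced, hval]
    push_cast
    apply le_of_eq
    ring
  by_cases htwo : ∃ M ∈ matchings T, ∃ M' ∈ matchings T, M ≠ M' ∧
      ∏ e ∈ M, degSum T e = 12 * 4 ^ j ∧ ∏ e ∈ M', degSum T e = 12 * 4 ^ j
  · obtain ⟨M, hM, M', hM', hne, hval, hval'⟩ := htwo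
    obtain ⟨hm1, hm4, hml⟩ := htop M hM hval
    obtain ⟨hm1', hm4', hml'⟩ := htop M' hM' hval'
    rcases deg_le_two_or_twins hT hM hM' hne hm4 hm4' hml hml' with
      h | ⟨v, w, x, hwx, hw, hx, hvw, hvx, hwc, hxc⟩
    · obtain ⟨v, hv⟩ := h3
      have := h v
      omega
    have hvw := adj_of_mem hM hvw
    have hvx := adj_of_mem hM' hvx
    have := sum_lt_of_exceptional (s := matchF T) (t := {M, M'})
      (by simp [Finset.insert_subset_iff, hM, hM'])
      (f := fun M => ((∏ e ∈ M, degSum T e : ℕ) : ℝ) ^ c) (m := 2)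
      (A := ((12 * 4 ^ j : ℕ) : ℝ) ^ c) hN Finset.card_le_two (h0 _) (h0 _)
      (by
        simp only [Finset.mem_insert, Finset.mem_singleton]
        rintro _ (rfl | rfl)
        · rw [hval]
        · rw [hval']) (fun N hN hne => by
        rw [mem_matchF] at hN
        refine rpow_le_pred hc (val_lt_of_card_le hT hV hN ?_) (K := 9 * 4 ^ j)
        by_contra hlt
        have hm := (hcard N hN hlt).1
        simp only [Finset.mem_insert, Finset.mem_singleton, not_or] at hne
        rcases not_mem_cov_of_twins hwx hw hx hvw hvx hN with h | h
        · exact hne.2 (eq_of_common_missed hT hN hM' hm hm1' h hwc)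
        · exact hne.1 (eq_of_common_missed hT hN hM hm hm1 h hxc)) hc2
    simpa using this
  · push Not at htwo
    have hone : ((matchF T).filter fun M => ∏ e ∈ M, degSum T e = 12 * 4 ^ j).card ≤ 1 := by
      rw [Finset.card_le_one]
      simp only [Finset.mem_filter, mem_matchF]
      rintro M ⟨hM, h1⟩ M' ⟨hM', h2⟩
      by_contra hne
      exact htwo M hM M' hM' hne h1 h2
    have := sum_lt_of_exceptional (s := matchF T) (Finset.filter_subset _ _)
      (f := fun M => ((∏ e ∈ M, degSum T e : ℕ) : ℝ) ^ c) (m := 1)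
      (A := ((12 * 4 ^ j : ℕ) : ℝ) ^ c) hN hone (h0 _) (h0 _)
      (by
        simp only [Finset.mem_filter]
        rintro M ⟨-, h⟩
        rw [h]) (fun M hM hne => by
        simp only [Finset.mem_filter, hM, true_and] at hne
        exact rpow_le_pred hc (lt_of_le_of_ne (val_le_near_perfect hT hV (mem_matchF.1 hM)) hne)) hc1
    have h9 := h0 (9 * 4 ^ j)
    push_cast at *
    linarith

theorem phi3_maximizer (n : ℕ) (hn : 1 ≤ n) : ∀ᶠ c : ℝ in Filter.atTop,
    IsUniqueMaximizer.{u, 0} (phi3 c) n (SimpleGraph.pathGraph n) := by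
  have hpos : ∀ j : ℕ, 1 ≤ 4 ^ j := fun j => Nat.one_le_pow _ _ (by norm_num)
  have h1 := fun j => eventually_mul_natPred_rpow_lt (2 ^ n) (K := 9 * 4 ^ j) (by
    have := hpos j; omega)
  have h2 := fun j => eventually_mul_natPred_rpow_lt (2 ^ n) (K := 12 * 4 ^ j) (by
    have := hpos j; omega)
  have h3 := fun j => eventually_mul_natPred_rpow_lt (2 ^ n) (K := 4 ^ (j + 1)) (hpos _)
  filter_upwards [h1 ((n - 4) / 2), h2 ((n - 4) / 2), h3 ((n - 4) / 2),
    Filter.eventually_ge_atTop 0] with c hc1 hc2 hc3 hc0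
  refine isUniqueMaximizer_of_lt (pathGraph_isTree hn) (by simp) fun U _ T hT hU hiso => ?_
  have hdeg := exists_three_le_deg hT hU hiso
  have hge := four_le_of_not_path hT hU hiso
  obtain ⟨j, rfl | rfl⟩ : ∃ j, n = 2 * j + 4 ∨ n = 2 * j + 5 := ⟨(n - 4) / 2, by omega⟩
  · rw [show (2 * j + 4 - 4) / 2 = j by omega] at hc1 hc2 hc3
    exact phi3_lt_even hT hU hdeg hc0 hc1 hc3
  · rw [show (2 * j + 5 - 4) / 2 = j by omega] at hc1 hc2 hc3
    exact phi3_lt_odd hT hU hdeg hc0 hc2 hc1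

end Comparison

end PhiThree

/-! ## Stars with legs of length two -/

section LegGraph

variable {B I : Type*}

/-- The star with centre `r` on the vertices `B`, with legs of length two, indexed by `I`, attached
at the vertices `h i`. The leg `i` has the inner vertex `inr (inl i)` and the leaf `inr (inr i)`. -/
def legGraph (r : B) (h : I → B) : SimpleGraph (B ⊕ (I ⊕ I)) :=
  SimpleGraph.fromRel fun
    | .inl x, .inl _ => x = r
    | .inl x, .inr (.inl i) => x = h i
    | .inr (.inl i), .inr (.inr j) => i = j
    | _, _ => False

variable {r : B} {h : I → B}

@[simp] theorem legGraph_adj_base {x y : B} :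
    (legGraph r h).Adj (.inl x) (.inl y) ↔ x ≠ y ∧ (x = r ∨ y = r) := by
  simp [legGraph]

@[simp] theorem legGraph_adj_base_inner {x : B} {i : I} :
    (legGraph r h).Adj (.inl x) (.inr (.inl i)) ↔ x = h i := by
  simp [legGraph]

@[simp] theorem legGraph_adj_inner_base {x : B} {i : I} :
    (legGraph r h).Adj (.inr (.inl i)) (.inl x) ↔ x = h i := by
  simp [legGraph]

@[simp] theorem legGraph_adj_base_leaf {x : B} {i : I} :
    ¬ (legGraph r h).Adj (.inl x) (.inr (.inr i)) := by
  simp [legGraph]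

@[simp] theorem legGraph_adj_leaf_base {x : B} {i : I} :
    ¬ (legGraph r h).Adj (.inr (.inr i)) (.inl x) := by
  simp [legGraph]

@[simp] theorem legGraph_adj_inner {i j : I} :
    ¬ (legGraph r h).Adj (.inr (.inl i)) (.inr (.inl j)) := by
  simp [legGraph]

@[simp] theorem legGraph_adj_inner_leaf {i j : I} :
    (legGraph r h).Adj (.inr (.inl i)) (.inr (.inr j)) ↔ i = j := by
  simp [legGraph]

@[simp] theorem legGraph_adj_leaf_inner {i j : I} :
    (legGraph r h).Adj (.inr (.inr i)) (.inr (.inl j)) ↔ i = j := by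
  simp [legGraph, eq_comm]

@[simp] theorem legGraph_adj_leaf {i j : I} :
    ¬ (legGraph r h).Adj (.inr (.inr i)) (.inr (.inr j)) := by
  simp [legGraph]

theorem legGraph_isTree [Finite B] [Finite I] (r : B) (h : I → B) : (legGraph r h).IsTree := by
  refine isTree_of_parent (.inl r)
    (fun v => match v with
      | .inl _ => .inl r
      | .inr (.inl i) => .inl (h i)
      | .inr (.inr i) => .inr (.inl i))
    (fun v => match v with
      | .inl x => if x = r then 0 else 1
      | .inr (.inl _) => 2
      | .inr (.inr _) => 3) ?_ ?_ ?_
  · rintro (x | i | i) hv <;> simp_all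
  · rintro (x | i | i) hv <;> simp_all
    split_ifs <;> omega
  · rintro (x | i | i) (y | j | j) <;> simp
    · rintro h1 (rfl | rfl)
      · exact Or.inr ⟨Ne.symm h1, rfl⟩
      · exact Or.inl ⟨h1, rfl⟩
    all_goals tauto

theorem deg_legGraph_leaf (i : I) : deg (legGraph r h) (.inr (.inr i)) = 1 := by
  have : (legGraph r h).neighborSet (.inr (.inr i)) = {.inr (.inl i)} := by
    ext (x | j | j) <;> simp [eq_comm]
  rw [deg, this, Set.ncard_singleton]

variable [Fintype B] [Fintype I]

/-- The matching of `legGraph r h` which contains the edges in `E` and, for each leg `i`, the edge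
at the base if `i ∈ J` and the edge at the leaf otherwise. -/
noncomputable def legEdges (h : I → B) (E : Finset (Sym2 B)) (J : Finset I) :
    Finset (Sym2 (B ⊕ (I ⊕ I))) :=
  univ.filter fun e => (∃ x y, s(x, y) ∈ E ∧ e = s(.inl x, .inl y)) ∨
    (∃ i ∈ J, e = s(.inl (h i), .inr (.inl i))) ∨ ∃ i, i ∉ J ∧ e = s(.inr (.inl i), .inr (.inr i))

variable {E : Finset (Sym2 B)} {J : Finset I}

@[simp] theorem mem_legEdges_base {x y : B} :
    s(.inl x, .inl y) ∈ legEdges h E J ↔ s(x, y) ∈ E := by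
  simp only [legEdges, Finset.mem_filter, Finset.mem_univ, true_and]
  constructor
  · rintro (⟨a, b, hab, he⟩ | ⟨i, hi, he⟩ | ⟨i, hi, he⟩)
    · have : s(x, y) = s(a, b) := by simpa using he
      rwa [this]
    · simp at he
    · simp at he
  · exact fun hxy => Or.inl ⟨x, y, hxy, rfl⟩

@[simp] theorem mem_legEdges_base_inner {x : B} {i : I} :
    s(.inl x, .inr (.inl i)) ∈ legEdges h E J ↔ i ∈ J ∧ x = h i := by
  simp [legEdges]

@[simp] theorem mem_legEdges_base_leaf {x : B} {i : I} :
    s(.inl x, .inr (.inr i)) ∉ legEdges h E J := by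
  simp [legEdges]

@[simp] theorem mem_legEdges_inner {i j : I} :
    s(.inr (.inl i), .inr (.inl j)) ∉ legEdges h E J := by
  simp [legEdges]

@[simp] theorem mem_legEdges_inner_leaf {i j : I} :
    s(.inr (.inl i), .inr (.inr j)) ∈ legEdges h E J ↔ i ∉ J ∧ i = j := by
  simp [legEdges]
  rintro rfl; rfl

@[simp] theorem mem_legEdges_leaf {i j : I} :
    s(.inr (.inr i), .inr (.inr j)) ∉ legEdges h E J := by
  simp [legEdges]

@[simp] theorem mem_legEdges_inner_base {x : B} {i : I} :
    s(.inr (.inl i), .inl x) ∈ legEdges h E J ↔ i ∈ J ∧ x = h i := by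
  rw [Sym2.eq_swap, mem_legEdges_base_inner]

@[simp] theorem mem_legEdges_leaf_base {x : B} {i : I} :
    s(.inr (.inr i), .inl x) ∉ legEdges h E J := by
  rw [Sym2.eq_swap]; exact mem_legEdges_base_leaf

@[simp] theorem mem_legEdges_leaf_inner {i j : I} :
    s(.inr (.inr j), .inr (.inl i)) ∈ legEdges h E J ↔ i ∉ J ∧ i = j := by
  rw [Sym2.eq_swap, mem_legEdges_inner_leaf]

theorem legEdges_mem_matchings (hE : E ∈ matchings (SimpleGraph.starGraph r))
    (hJ : Set.InjOn h J) (hd : ∀ i ∈ J, h i ∉ cov E) :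
    legEdges h E J ∈ matchings (legGraph r h) := by
  rw [mem_matchings_iff]
  constructor
  · rintro (x | i | i) (y | j | j) <;> simp <;> intro h1
    · simpa using adj_of_mem hE h1
    all_goals tauto
  · rintro (x | i | i) (y | j | j) (z | l | l) <;> simp <;> intro h1
    · exact fun h2 => eq_of_mem hE h1 h2
    · rintro h2 rfl
      exact hd l h2 (mem_cov_left h1)
    · rintro rfl h2
      exact hd j h1 (mem_cov_left h2)
    · rintro rfl h2 h3
      exact hJ h1 h2 h3
    all_goals aesop

theorem missed_legEdges (hcov : ∀ x, x ∈ cov E ∨ ∃ i ∈ J, x = h i) :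
    missed (legEdges h E J) = J.image fun i => .inr (.inr i) := by
  ext v
  rw [mem_missed, mem_cov]
  rcases v with (x | i | i)
  · simp only [Finset.mem_image, reduceCtorEq, and_false, exists_false, iff_false, not_not]
    rcases hcov x with hx | ⟨i, hi, rfl⟩
    · obtain ⟨y, hy⟩ := mem_cov.1 hx
      exact ⟨.inl y, by simpa⟩
    · exact ⟨.inr (.inl i), by simpa⟩
  · simp only [Finset.mem_image, Sum.inr.injEq, reduceCtorEq, and_false, exists_false, iff_false,
      not_not]
    by_cases hi : i ∈ J
    · exact ⟨.inl (h i), by simpa⟩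
    · exact ⟨.inr (.inr i), by simpa⟩
  · simp

theorem sum_cov_legEdges (hcov : ∀ x, x ∈ cov E ∨ ∃ i ∈ J, x = h i) :
    ∑ v ∈ cov (legEdges h E J), deg (legGraph r h) v + J.card + 2 =
      2 * (Fintype.card B + 2 * Fintype.card I) := by
  have h1 := sum_deg (legGraph_isTree r h)
  rw [← sum_cov_add_sum_missed (M := legEdges h E J), missed_legEdges hcov,
    Finset.sum_image (by simp)] at h1
  simp only [deg_legGraph_leaf, Finset.sum_const, smul_eq_mul, mul_one, Fintype.card_sum] at h1
  omega

/-- A tree with the vertices and edges of a `legGraph` is that graph. -/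
theorem nonempty_iso_legGraph {V : Type*} [Fintype V] {T : SimpleGraph V} (hT : T.IsTree)
    (hcard : Fintype.card V = Fintype.card B + 2 * Fintype.card I)
    {β : B → V} {μ ν : I → V} (hβ : Function.Injective β) (hμ : Function.Injective μ)
    (hν : Function.Injective ν) (hβμ : ∀ x i, β x ≠ μ i) (hβν : ∀ x i, β x ≠ ν i)
    (hμν : ∀ i j, μ i ≠ ν j) (h1 : ∀ x, x ≠ r → T.Adj (β r) (β x))
    (h2 : ∀ i, T.Adj (β (h i)) (μ i)) (h3 : ∀ i, T.Adj (μ i) (ν i)) :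
    Nonempty (T ≃g legGraph r h) := by
  obtain ⟨F⟩ := nonempty_iso_of_injective_hom (legGraph_isTree r h) hT
    (by simp [hcard]; omega) (Sum.elim β (Sum.elim μ ν))
    (by
      rintro (x | i | i) (y | j | j) hij <;> simp only [Sum.elim_inl, Sum.elim_inr] at hij
      · rw [hβ hij]
      · exact absurd hij (hβμ _ _)
      · exact absurd hij (hβν _ _)
      · exact absurd hij.symm (hβμ _ _)
      · rw [hμ hij]
      · exact absurd hij (hμν _ _)
      · exact absurd hij.symm (hβν _ _)
      · exact absurd hij.symm (hμν _ _)
      · rw [hν hij])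
    (by
      rintro (x | i | i) (y | j | j) <;> simp only [Sum.elim_inl, Sum.elim_inr, legGraph_adj_base,
        legGraph_adj_base_inner, legGraph_adj_inner_base, legGraph_adj_base_leaf,
        legGraph_adj_leaf_base, legGraph_adj_inner, legGraph_adj_inner_leaf,
        legGraph_adj_leaf_inner, legGraph_adj_leaf, false_imp_iff]
      · rintro ⟨hxy, rfl | rfl⟩
        · exact h1 y (Ne.symm hxy)
        · exact (h1 x hxy).symm
      · rintro rfl; exact h2 j
      · rintro rfl; exact (h2 i).symm
      · rintro rfl; exact h3 i
      · rintro rfl; exact (h3 i).symm)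
  exact ⟨F.symm⟩

end LegGraph

theorem nonempty_subdivide_iso_legGraph {B I X : Type*} {r : B} {h : I → B} {G : SimpleGraph X} {S : Set (Sym2 X)}
    {ψ : B ⊕ I → X} (hψ : Function.Bijective ψ)
    (hbase : ∀ x y, G.Adj (ψ (.inl x)) (ψ (.inl y)) ↔ x ≠ y ∧ (x = r ∨ y = r))
    (hleg : ∀ x i, G.Adj (ψ (.inl x)) (ψ (.inr i)) ↔ x = h i)
    (hleaf : ∀ i j, ¬ G.Adj (ψ (.inr i)) (ψ (.inr j)))
    (hS : S = Set.range fun i => s(ψ (.inl (h i)), ψ (.inr i))) :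
    Nonempty (legGraph r h ≃g subdivide G S) := by
  subst hS
  set S : Set (Sym2 X) := Set.range fun i => s(ψ (.inl (h i)), ψ (.inr i)) with hS
  have hmemS : ∀ i, s(ψ (.inl (h i)), ψ (.inr i)) ∈ S := fun i => ⟨i, rfl⟩
  have hbS : ∀ x y, s(ψ (.inl x), ψ (.inl y)) ∉ S := by
    rintro x y ⟨i, hi⟩
    simp [hψ.1.eq_iff] at hi
  have hlS : ∀ x i, s(ψ (.inl x), ψ (.inr i)) ∈ S ↔ x = h i := by
    intro x i
    constructor
    · rintro ⟨j, hj⟩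
      simp [hψ.1.eq_iff] at hj
      rw [← hj.1, hj.2]
    · rintro rfl; exact hmemS i
  let F : B ⊕ (I ⊕ I) → X ⊕ S :=
    Sum.elim (fun x => .inl (ψ (.inl x)))
      (Sum.elim (fun i => .inr ⟨_, hmemS i⟩) fun i => .inl (ψ (.inr i)))
  have hF : Function.Bijective F := by
    constructor
    · rintro (x | i | i) (y | j | j) hij <;>
        simp [F, hψ.1.eq_iff] at hij <;> simp [hij]
    · rintro (x | ⟨e, i, rfl⟩)
      · obtain ⟨x | i, rfl⟩ := hψ.2 x
        · exact ⟨.inl x, rfl⟩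
        · exact ⟨.inr (.inr i), rfl⟩
      · exact ⟨.inr (.inl i), rfl⟩
  refine ⟨⟨Equiv.ofBijective F hF, fun {v w} => ?_⟩⟩
  change (subdivide G S).Adj (F v) (F w) ↔ _
  rcases v with (x | i | i) <;> rcases w with (y | j | j) <;>
    simp [F, subdivide, hψ.1.eq_iff, hbase, hleg, hleaf, hbS, hlS]
  · exact eq_comm
  · rw [Sym2.eq_swap, G.adj_comm, hlS, hleg]
    exact id

/-! ## The weight `c ^ (i + j)`: odd order -/

section PhiOneOdd

section

variable {V : Type*} [Fintype V] {T : SimpleGraph V} {M : Finset (Sym2 V)}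

theorem sum_cov_deg_add (hT : T.IsTree) (M : Finset (Sym2 V)) :
    ∑ v ∈ cov M, deg T v + ∑ v ∈ missed M, deg T v + 2 = 2 * Fintype.card V := by
  rw [sum_cov_add_sum_missed, sum_deg hT]

theorem eq_of_missed_eq (hT : T.IsTree) {M M' : Finset (Sym2 V)} (hM : M ∈ matchings T)
    (hM' : M' ∈ matchings T) (h : missed M = missed M') : M = M' := by
  refine eq_of_cov_eq hT hM hM' ?_
  ext v
  rw [← not_iff_not, ← mem_missed, ← mem_missed, h]

theorem sum_missed_sign {f : V → ℤ} (hf : ∀ v w, T.Adj v w → f v + f w = 0)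
    (hM : M ∈ matchings T) : ∑ v ∈ missed M, f v = ∑ v, f v := by
  rw [← sum_cov_add_sum_missed (M := M), sum_cov_sign hM hf, zero_add]

/-- If a tree of order `2 * k + 1` has `k` leaves each of which is the only vertex missed by some
matching, then it is an odd spider. -/
theorem nonempty_iso_spider (hT : T.IsTree) {k : ℕ} (hk : 3 ≤ k)
    (hV : Fintype.card V = 2 * k + 1) {u : Fin k → V} (hu : Function.Injective u)
    (hdeg : ∀ i, deg T (u i) = 1) {M : Fin k → Finset (Sym2 V)} (hM : ∀ i, M i ∈ matchings T)
    (hms : ∀ i, missed (M i) = {u i}) :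
    Nonempty (T ≃g legGraph () fun _ : Fin k => ()) := by
  obtain ⟨f, hf1, hf⟩ := exists_sign hT
  set σ := ∑ v, f v with hσ
  have hfu : ∀ i, f (u i) = σ := fun i => by
    rw [hσ, ← sum_missed_sign hf (hM i), hms, Finset.sum_singleton]
  have hσ1 : σ = 1 ∨ σ = -1 := hfu ⟨0, by omega⟩ ▸ hf1 _
  set X := univ.filter fun v => f v = σ with hX
  have hXcard : X.card = k + 1 := by
    have h1 : ∑ v, σ * f v = 1 := by
      rw [← Finset.mul_sum, ← hσ]
      rcases hσ1 with h | h <;> rw [h] <;> rfl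
    have h2 : ∀ v, σ * f v = 2 * (if f v = σ then 1 else 0) - 1 := by
      intro v
      rcases hσ1 with h | h <;> rcases hf1 v with h' | h' <;> rw [h, h'] <;> norm_num
    simp only [h2, Finset.sum_sub_distrib, ← Finset.mul_sum, Finset.sum_boole] at h1
    simp only [Finset.sum_const, Finset.card_univ, hV] at h1
    have h3 : (2 * X.card - (2 * k + 1) : ℤ) = 1 := by
      rw [hX]
      simpa using h1
    omega
  have hsub : univ.image u ⊆ X := by
    intro v hv
    obtain ⟨i, -, rfl⟩ := Finset.mem_image.1 hv
    simp [hX, hfu]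
  have hcard1 : (X \ univ.image u).card = 1 := by
    rw [Finset.card_sdiff_of_subset hsub, Finset.card_image_of_injective _ hu, hXcard]
    simp
  obtain ⟨x, hx⟩ := Finset.card_eq_one.1 hcard1
  have hxX : f x = σ ∧ ∀ i, u i ≠ x := by
    have : x ∈ X \ univ.image u := by rw [hx]; simp
    simpa [hX] using this
  have hXx : ∀ v, f v = σ → v = x ∨ ∃ i, v = u i := by
    intro v hv
    by_cases h : ∃ i, v = u i
    · exact Or.inr h
    · left
      have : v ∈ X \ univ.image u := by
        simp only [hX, Finset.mem_sdiff, Finset.mem_filter, Finset.mem_univ, true_and, hv,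
          Finset.mem_image, not_exists]
        exact fun i hi => h ⟨i, hi.symm⟩
      rw [hx] at this
      simpa using this
  have hex : ∀ i, ∃ y, T.Adj (u i) y := by
    intro i
    have : (T.neighborSet (u i)).Nonempty := by
      rw [← Set.ncard_pos (Set.toFinite _)]
      have := hdeg i
      rw [deg] at this
      omega
    exact this
  choose y hy using hex
  have hfy : ∀ i, f (y i) = -σ := fun i => by
    have := hf _ _ (hy i)
    rw [hfu] at this
    omega
  have hyinj : Function.Injective y := by
    intro i j hij
    by_contra hne
    obtain ⟨l, hl⟩ : ∃ l : Fin k, l ≠ i ∧ l ≠ j := by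
      have h2 : ({i, j} : Finset (Fin k)).card < (univ : Finset (Fin k)).card :=
        lt_of_le_of_lt Finset.card_le_two (by simp; omega)
      obtain ⟨l, -, hl⟩ := Finset.exists_mem_notMem_of_card_lt_card h2
      simp at hl
      exact ⟨l, hl⟩
    have hc : ∀ a, l ≠ a → s(u a, y a) ∈ M l := by
      intro a ha
      have : u a ∈ cov (M l) := by
        by_contra hh
        rw [← mem_missed, hms, Finset.mem_singleton] at hh
        exact ha (hu hh).symm
      obtain ⟨b, hb⟩ := mem_cov.1 this
      rwa [eq_of_deg_eq_one (hdeg a) (hy a) (adj_of_mem (hM l) hb)]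
    have h1 := hc i hl.1
    have h2 := hc j hl.2
    rw [hij, Sym2.eq_swap] at h1
    rw [Sym2.eq_swap] at h2
    exact hne (hu (eq_of_mem (hM l) h1 h2))
  have hσ0 : σ ≠ -σ := by omega
  have hxy : ∀ i, T.Adj x (y i) := by
    intro i
    by_contra hadj
    have hmem := eq_univ_of_adj_closed hT.connected (D := {u i, y i}) ⟨u i, by simp⟩ (by
      rintro v (rfl | rfl) w hw
      · rw [eq_of_deg_eq_one (hdeg i) hw (hy i)]; simp
      · have hfw : f w = σ := by
          have := hf _ _ hw
          rw [hfy] at this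
          omega
        rcases hXx w hfw with rfl | ⟨j, rfl⟩
        · exact absurd hw.symm hadj
        · have : y i = y j := eq_of_deg_eq_one (hdeg j) hw.symm (hy j)
          rw [hyinj this]; simp) x
    rcases hmem with h | h
    · exact hxX.2 i h.symm
    · exact hσ0 (by rw [← hfy i, ← h, hxX.1])
  refine nonempty_iso_legGraph hT (by simp [hV]; omega) (β := fun _ => x) (μ := y) (ν := u)
    (fun _ _ _ => rfl) hyinj hu ?_ ?_ ?_ ?_ ?_ ?_
  · rintro - i rfl
    exact hσ0 (by rw [← hfy i, hxX.1])
  · exact fun _ i h => hxX.2 i h.symm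
  · intro i j h
    exact hσ0 (by rw [← hfy i, h, hfu])
  · exact fun b hb => absurd rfl hb
  · exact fun i => hxy i
  · exact fun i => (hy i).symm

theorem phi1_lt_spider (hT : T.IsTree) {k : ℕ} (hk : 3 ≤ k) (hV : Fintype.card V = 2 * k + 1)
    (hiso : IsEmpty (T ≃g legGraph () fun _ : Fin k => ())) {c : ℝ}
    (hc : ((2 ^ (2 * k + 1) : ℕ) : ℝ) + 1 ≤ c) : Z (phi1 c) T < k * c ^ (4 * k - 1) := by
  have hc1 : 1 ≤ c := by have := Nat.cast_nonneg (α := ℝ) (2 ^ (2 * k + 1)); linarith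
  have hc0 : 0 ≤ c := by linarith
  rw [Z_phi1]
  set t := (matchF T).filter fun M => ∑ v ∈ missed M, deg T v = 1 with ht
  have htk : t.card ≤ k - 1 := by
    by_contra hlt
    obtain ⟨t', ht', hcard⟩ := Finset.exists_subset_card_eq (show k ≤ t.card by omega)
    let e := Finset.equivFinOfCardEq hcard
    have hprop : ∀ i, ∃ u, missed (e.symm i).1 = {u} ∧ deg T u = 1 := by
      intro i
      have h1 : (e.symm i).1 ∈ t := ht' (e.symm i).2
      rw [ht, Finset.mem_filter, mem_matchF] at h1
      have h2 := card_missed h1.1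
      have h3 := card_missed_le_sum_deg (M := (e.symm i).1) hT (by omega)
      obtain ⟨u, hu⟩ := Finset.card_eq_one.1 (show (missed (e.symm i).1).card = 1 by omega)
      exact ⟨u, hu, by simpa [hu] using h1.2⟩
    choose u hu hdeg using hprop
    have hM : ∀ i, (e.symm i).1 ∈ matchings T := fun i => by
      have h1 : (e.symm i).1 ∈ t := ht' (e.symm i).2
      rw [ht, Finset.mem_filter, mem_matchF] at h1
      exact h1.1
    refine hiso.false (nonempty_iso_spider hT hk hV (u := u) ?_ hdeg hM hu).some
    intro i j hij
    exact e.symm.injective (Subtype.ext (eq_of_missed_eq hT (hM i) (hM j) (by rw [hu, hu, hij])))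
  have := sum_lt_of_exceptional (s := matchF T) (t := t) (Finset.filter_subset _ _)
    (f := fun M => c ^ (∑ v ∈ cov M, deg T v)) (m := k - 1) (A := c ^ (4 * k - 1))
    (B := c ^ (4 * k - 2)) (hV ▸ card_matchF_le hT) htk (pow_nonneg hc0 _) (pow_nonneg hc0 _)
    (by
      intro M hM
      rw [ht, Finset.mem_filter] at hM
      have := sum_cov_deg_add hT M
      exact pow_le_pow_right₀ hc1 (by omega)) (by
      intro M hM hMt
      have h1 := sum_cov_deg_add hT M
      have h2 := card_missed (mem_matchF.1 hM)
      have h3 := card_missed_le_sum_deg (M := M) hT (by omega)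
      rw [ht, Finset.mem_filter, not_and] at hMt
      have := hMt hM
      exact pow_le_pow_right₀ hc1 (by omega)) (mul_pow_lt_pow_succ hc (4 * k - 2))
  rw [show 4 * k - 2 + 1 = 4 * k - 1 by omega, Nat.cast_sub (by omega)] at this
  refine this.trans_le (le_of_eq ?_)
  push_cast
  ring

end

theorem sum_comp_le_sum_matchF {V ι : Type*} [Fintype V] [Fintype ι] {G : SimpleGraph V}
    {F : Finset (Sym2 V) → ℝ} (hF : ∀ M, 0 ≤ F M) {g : ι → Finset (Sym2 V)}
    (hg : Function.Injective g) (hM : ∀ i, g i ∈ matchings G) :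
    ∑ i, F (g i) ≤ ∑ M ∈ matchF G, F M := by
  rw [← Finset.sum_image (s := univ) (g := g) (f := F) fun i _ j _ h => hg h]
  refine Finset.sum_le_sum_of_subset_of_nonneg ?_ fun M _ _ => hF M
  intro M hM'
  obtain ⟨i, -, rfl⟩ := Finset.mem_image.1 hM'
  exact mem_matchF.2 (hM i)

theorem empty_mem_matchings {V : Type*} (G : SimpleGraph V) : (∅ : Finset (Sym2 V)) ∈ matchings G :=
  ⟨by simp, by simp⟩

theorem le_Z_phi1_spider (k : ℕ) (hk : 1 ≤ k) {c : ℝ} (hc : 0 ≤ c) :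
    k * c ^ (4 * k - 1) ≤ Z (phi1 c) (legGraph () fun _ : Fin k => ()) := by
  rw [Z_phi1]
  have hcov : ∀ i : Fin k, ∀ x : Unit,
      x ∈ cov (∅ : Finset (Sym2 Unit)) ∨ ∃ j ∈ ({i} : Finset (Fin k)), x = () := fun i x =>
    Or.inr ⟨i, by simp⟩
  refine le_trans (le_of_eq ?_) (sum_comp_le_sum_matchF (fun M => pow_nonneg hc _)
    (g := fun i : Fin k => legEdges (fun _ => ()) ∅ {i}) ?_ fun i => ?_)
  · rw [Finset.sum_congr rfl (g := fun _ => c ^ (4 * k - 1)), Finset.sum_const, Finset.card_univ,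
      Fintype.card_fin, nsmul_eq_mul]
    intro i _
    have := sum_cov_legEdges (r := ()) (hcov i)
    rw [Finset.card_singleton, Fintype.card_unit, Fintype.card_fin] at this
    congr 1
    omega
  · intro i j hij
    have := congrArg missed hij
    simpa [missed_legEdges (hcov _)] using this
  · refine legEdges_mem_matchings (empty_mem_matchings _) (by simp) ?_
    simp [cov]

theorem nonempty_legGraph_iso_oddSpider (n : ℕ) :
    Nonempty (legGraph () (fun _ : Fin (n / 2) => ()) ≃g oddSpider n) := by
  refine nonempty_subdivide_iso_legGraph
    (ψ := Sum.elim (fun _ => 0) Fin.succ) ?_ ?_ ?_ ?_ ?_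
  · constructor
    · rintro (x | i) (y | j) hij <;> simp at hij ⊢
      · exact absurd hij.symm (Fin.succ_ne_zero _)
      · exact hij
    · intro x
      refine Fin.cases ⟨.inl (), rfl⟩ (fun i => ⟨.inr i, rfl⟩) x
  · simp
  · simp [Fin.succ_ne_zero, eq_comm]
  · simp [Fin.succ_ne_zero]
  · ext e
    induction e with
    | _ x y =>
      simp only [SimpleGraph.mem_edgeSet, SimpleGraph.starGraph_adj, Set.mem_range, Sum.elim_inl,
        Sum.elim_inr]
      constructor
      · rintro ⟨hne, rfl | rfl⟩
        · obtain ⟨i, rfl⟩ := Fin.exists_succ_eq.2 (Ne.symm hne)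
          exact ⟨i, rfl⟩
        · obtain ⟨i, rfl⟩ := Fin.exists_succ_eq.2 hne
          exact ⟨i, Sym2.eq_swap⟩
      · rintro ⟨i, hi⟩
        rcases Sym2.eq_iff.1 hi with ⟨rfl, rfl⟩ | ⟨rfl, rfl⟩
        · exact ⟨(Fin.succ_ne_zero i).symm, Or.inl rfl⟩
        · exact ⟨Fin.succ_ne_zero i, Or.inr rfl⟩

theorem phi1_maximizer_odd (n : ℕ) (hn : 7 ≤ n) (hodd : Odd n) : ∀ᶠ c : ℝ in Filter.atTop,
    IsUniqueMaximizer.{u, 0} (phi1 c) n (oddSpider n) := by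
  have hn2 : n = 2 * (n / 2) + 1 := by
    obtain ⟨k, rfl⟩ := hodd
    omega
  filter_upwards [Filter.eventually_ge_atTop (((2 ^ (2 * (n / 2) + 1) : ℕ) : ℝ) + 1)] with c hc
  have hc0 : 0 ≤ c := by have := Nat.cast_nonneg (α := ℝ) (2 ^ (2 * (n / 2) + 1)); linarith
  obtain ⟨F⟩ := nonempty_legGraph_iso_oddSpider n
  refine IsUniqueMaximizer.of_iso (isUniqueMaximizer_of_lt (legGraph_isTree _ _)
    (by simp; omega) fun U _ T hT hU hiso => ?_) F
  exact (phi1_lt_spider hT (by omega) (hU.trans hn2) hiso hc).trans_le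
    (le_Z_phi1_spider (n / 2) (by omega) hc0)

end PhiOneOdd

/-! ## The weight `c ^ (i + j)`: even order -/

section PhiOneEven

section Cycles

variable {V : Type*} {T : SimpleGraph V}

theorem not_four_cycle (hT : T.IsTree) {a b c d : V} (hab : T.Adj a b) (hbc : T.Adj b c)
    (hcd : T.Adj c d) (hda : T.Adj d a) (hac : a ≠ c) (hbd : b ≠ d) : False := by
  obtain ⟨v, hv, h⟩ := exists_mem_neighbors_subsingleton hT (D := {a, b, c, d})
    (Set.toFinite _) ⟨a, by simp⟩
  rcases hv with rfl | rfl | rfl | rfl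
  · exact hbd (h b (by simp) d (by simp) hab hda.symm)
  · exact hac (h a (by simp) c (by simp) hab.symm hbc)
  · exact hbd (h b (by simp) d (by simp) hbc.symm hcd)
  · exact hac (h a (by simp) c (by simp) hda hcd.symm)

theorem not_six_cycle (hT : T.IsTree) {a b c d e f : V} (hab : T.Adj a b) (hbc : T.Adj b c)
    (hcd : T.Adj c d) (hde : T.Adj d e) (hef : T.Adj e f) (hfa : T.Adj f a)
    (h1 : b ≠ f) (h2 : a ≠ c) (h3 : b ≠ d) (h4 : c ≠ e) (h5 : d ≠ f) (h6 : e ≠ a) : False := by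
  obtain ⟨v, hv, h⟩ := exists_mem_neighbors_subsingleton hT (D := {a, b, c, d, e, f})
    (Set.toFinite _) ⟨a, by simp⟩
  rcases hv with rfl | rfl | rfl | rfl | rfl | rfl
  · exact h1 (h b (by simp) f (by simp) hab hfa.symm)
  · exact h2 (h a (by simp) c (by simp) hab.symm hbc)
  · exact h3 (h b (by simp) d (by simp) hbc.symm hcd)
  · exact h4 (h c (by simp) e (by simp) hcd.symm hde)
  · exact h5 (h d (by simp) f (by simp) hde.symm hef)
  · exact h6 (h e (by simp) a (by simp) hef.symm hfa)

/-- If every vertex of `P` and every vertex of `Q` are adjacent, or else joined through the edge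
`xy`, then all vertices of `P` are adjacent to `x`. -/
theorem adj_of_joined (hT : T.IsTree) {x y : V} (hxy : T.Adj x y) {P Q : Finset V}
    (hP : 2 ≤ P.card) (hQ : 2 ≤ Q.card) (hyP : y ∉ P) (hxQ : x ∉ Q)
    (hjoin : ∀ p ∈ P, ∀ q ∈ Q, T.Adj p q ∨ (T.Adj p x ∧ T.Adj y q)) {p : V} (hp : p ∈ P) :
    T.Adj p x := by
  by_contra hpx
  obtain ⟨q₁, hq₁, q₂, hq₂, hq⟩ := Finset.one_lt_card.1 hQ
  obtain ⟨p', hp', hne⟩ := Finset.exists_mem_ne hP p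
  have h : ∀ q ∈ Q, T.Adj p q := fun q hq => (hjoin p hp q hq).resolve_right fun h => hpx h.1
  have hpy : p ≠ y := fun h => hyP (h ▸ hp)
  have hpy' : p' ≠ y := fun h => hyP (h ▸ hp')
  have main : ∀ q₁ ∈ Q, ∀ q₂ ∈ Q, q₁ ≠ q₂ → T.Adj p' x → T.Adj y q₁ → False := by
    intro q₁ hq₁ q₂ hq₂ hq hx hy
    rcases hjoin p' hp' q₂ hq₂ with h2 | ⟨-, h2⟩
    · exact not_six_cycle hT (h q₁ hq₁) hy.symm hxy.symm hx.symm h2 (h q₂ hq₂).symm hq hpy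
        (fun h => hxQ (h ▸ hq₁)) hpy'.symm (fun h => hxQ (h ▸ hq₂)) hne
    · exact not_four_cycle hT (h q₁ hq₁) hy.symm h2 (h q₂ hq₂).symm hpy hq
  rcases hjoin p' hp' q₁ hq₁ with h1 | ⟨h1, h1'⟩
  · rcases hjoin p' hp' q₂ hq₂ with h2 | ⟨h2, h2'⟩
    · exact not_four_cycle hT (h q₁ hq₁) h1.symm h2 (h q₂ hq₂).symm hne.symm hq
    · exact main q₂ hq₂ q₁ hq₁ hq.symm h2 h2'
  · exact main q₁ hq₁ q₂ hq₂ hq h1 h1'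

end Cycles

variable {V : Type*} [Fintype V] {T : SimpleGraph V}

/-- The end of the central edge to which a leg of a wide spider is attached. -/
abbrev legSide (a b : ℕ) : Fin a ⊕ Fin b → Bool := Sum.elim (fun _ => false) fun _ => true

/-- The wide spider with `a` and `b` legs at the ends of its central edge. -/
abbrev wideSpider (a b : ℕ) : SimpleGraph (Bool ⊕ ((Fin a ⊕ Fin b) ⊕ (Fin a ⊕ Fin b))) :=
  legGraph false (legSide a b)

theorem nonempty_iso_wideSpider_of_adj (hT : T.IsTree) {a b : ℕ}
    (hV : Fintype.card V = 2 * (a + b + 1)) {m : V → V} (hm : ∀ v, m (m v) = v)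
    (hadj : ∀ v, T.Adj v (m v)) {x : V} {L₁ L₂ : Finset V} (h₁ : L₁.card = a) (h₂ : L₂.card = b)
    (hd : Disjoint L₁ L₂) (hmL : ∀ u ∈ L₁ ∪ L₂, m u ∉ L₁ ∪ L₂) (hx : x ∉ L₁ ∪ L₂)
    (hmx : m x ∉ L₁ ∪ L₂) (hx₁ : ∀ u ∈ L₁, T.Adj x (m u)) (hx₂ : ∀ u ∈ L₂, T.Adj (m x) (m u)) :
    Nonempty (T ≃g wideSpider a b) := by
  have hinj : Function.Injective m := Function.LeftInverse.injective hm
  let e₁ := Finset.equivFinOfCardEq h₁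
  let e₂ := Finset.equivFinOfCardEq h₂
  let ν : Fin a ⊕ Fin b → V := Sum.elim (fun i => (e₁.symm i).1) fun i => (e₂.symm i).1
  have hνL : ∀ i, ν i ∈ L₁ ∪ L₂ := by
    rintro (i | i)
    · exact Finset.mem_union_left _ (e₁.symm i).2
    · exact Finset.mem_union_right _ (e₂.symm i).2
  have hν : Function.Injective ν := by
    rintro (i | i) (j | j) hij
    · rw [e₁.symm.injective (Subtype.ext hij)]
    · exact absurd hij (Finset.disjoint_left.1 hd (e₁.symm i).2 |> fun h h' => h (by
        have := (e₂.symm j).2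
        simp only [ν, Sum.elim_inl, Sum.elim_inr] at h'
        rwa [← h'] at this))
    · exact absurd hij.symm (Finset.disjoint_left.1 hd (e₁.symm j).2 |> fun h h' => h (by
        have := (e₂.symm i).2
        simp only [ν, Sum.elim_inl, Sum.elim_inr] at h'
        rwa [← h'] at this))
    · rw [e₂.symm.injective (Subtype.ext hij)]
  have hβ : ∀ c : Bool, (if c then m x else x) ∉ L₁ ∪ L₂ ∧ m (if c then m x else x) ∉ L₁ ∪ L₂ := by
    rintro (_ | _)
    · simpa using ⟨by simpa using hx, by simpa using hmx⟩
    · simp only [if_true, hm]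
      exact ⟨hmx, hx⟩
  refine nonempty_iso_legGraph hT (by simp [hV]; omega) (β := fun c => if c then m x else x)
    (μ := fun i => m (ν i)) (ν := ν) ?_ (hinj.comp hν) hν ?_ ?_ ?_ ?_ ?_ ?_
  · have := (hadj x).ne
    rintro (_ | _) (_ | _) h <;> simp_all
  · intro c i h
    refine (hβ c).2 ?_
    rw [h, hm]
    exact hνL i
  · intro c i h
    exact (hβ c).1 (h ▸ hνL i)
  · intro i j h
    exact hmL _ (hνL i) (h ▸ hνL j)
  · rintro (_ | _) h
    · exact absurd rfl h
    · simpa using hadj x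
  · rintro (i | i)
    · simpa [ν] using hx₁ _ (e₁.symm i).2
    · simpa [ν] using hx₂ _ (e₂.symm i).2
  · exact fun i => (hadj _).symm

theorem adj_partner_of_missed_pair (hT : T.IsTree) (h3 : 3 ≤ Fintype.card V) {m : V → V}
    (hm : ∀ v, m (m v) = v) (hadj : ∀ v, T.Adj v (m v)) {u v : V}
    (hu : deg T u = 1) (hv : deg T v = 1) {M : Finset (Sym2 V)} (hM : M ∈ matchings T)
    (hms : missed M = {u, v}) :
    T.Adj (m u) (m v) ∨ ∃ z, T.Adj (m u) z ∧ deg T z ≠ 1 ∧ deg T (m z) ≠ 1 := by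
  have hmiss : ∀ w, w ∉ cov M ↔ w = u ∨ w = v := fun w => by
    rw [← mem_missed, hms]; simp
  have hmu : deg T (m u) ≠ 1 := fun h => by
    have := three_le_deg_add_deg hT (by rwa [Nat.card_eq_fintype_card]) (hadj u)
    omega
  have hcov : m u ∈ cov M := by
    by_contra h
    rcases (hmiss _).1 h with h | h
    · exact hmu (by rw [h]; exact hu)
    · exact hmu (by rw [h]; exact hv)
  obtain ⟨z, hz⟩ := mem_cov.1 hcov
  have hadjz := adj_of_mem hM hz
  by_cases hz1 : deg T z = 1
  · have h1 : m u = m z := eq_of_deg_eq_one hz1 hadjz.symm (hadj z)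
    have h2 : u = z := by rw [← hm u, h1, hm]
    exact absurd (mem_cov_right hz) ((hmiss z).2 (Or.inl h2.symm))
  by_cases hz2 : deg T (m z) = 1
  · rcases eq_or_ne (m z) u with h | hne
    · rw [← h, hm] at hadjz
      exact absurd rfl hadjz.ne
    rcases eq_or_ne (m z) v with h | hne'
    · left
      rw [← h, hm]
      exact hadjz
    · have hc : m z ∈ cov M := by
        by_contra hc
        rcases (hmiss _).1 hc with h | h
        · exact hne h
        · exact hne' h
      obtain ⟨a, ha⟩ := mem_cov.1 hc
      have h1 : a = z := eq_of_deg_eq_one hz2 (adj_of_mem hM ha) (hadj z).symm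
      subst h1
      rw [Sym2.eq_swap] at ha hz
      exact absurd (eq_of_mem hM ha hz ▸ hz2) hmu
  · exact Or.inr ⟨z, hadjz, hz1, hz2⟩

/-- In a tree with a perfect matching, given by the partners `m v`, the pendant edges and the edges
joining the partners of two leaves are distinct edges, so there are fewer of them than vertices. -/
theorem card_pairs_add_card_leaves_lt (hT : T.IsTree) (h3 : 3 ≤ Fintype.card V) {m : V → V}
    (hm : ∀ v, m (m v) = v) (hadj : ∀ v, T.Adj v (m v)) {f : V → ℤ} {P : Finset (V × V)}
    (hP : ∀ p ∈ P, f p.1 = 1 ∧ f p.2 = -1 ∧ deg T p.1 = 1 ∧ deg T p.2 = 1 ∧ T.Adj (m p.1) (m p.2)) :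
    P.card + (univ.filter fun v => deg T v = 1).card < Fintype.card V := by
  have hmL : ∀ u, deg T u = 1 → deg T (m u) ≠ 1 := fun u hu h => by
    have := three_le_deg_add_deg hT (by rwa [Nat.card_eq_fintype_card]) (hadj u)
    omega
  have hinj : Function.Injective m := Function.LeftInverse.injective hm
  have h1 : (P.image fun p => s(m p.1, m p.2)).card = P.card := by
    refine Finset.card_image_of_injOn ?_
    rintro ⟨a, b⟩ hp ⟨a', b'⟩ hp' h
    obtain ⟨ha, hb, -⟩ := hP _ hp
    obtain ⟨ha', hb', -⟩ := hP _ hp'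
    rcases Sym2.eq_iff.1 h with ⟨h1, h2⟩ | ⟨h1, h2⟩
    · exact Prod.ext (hinj h1) (hinj h2)
    · have e := hinj h1
      simp only at e ha hb'
      rw [e, hb'] at ha
      omega
  have h2 : ((univ.filter fun v => deg T v = 1).image fun u => s(u, m u)).card =
      (univ.filter fun v => deg T v = 1).card := by
    refine Finset.card_image_of_injOn ?_
    intro a ha b hb h
    simp only [Finset.coe_filter, Finset.mem_univ, true_and, Set.mem_ofPred_eq] at ha hb
    rcases Sym2.eq_iff.1 h with ⟨h1, h2⟩ | ⟨h1, h2⟩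
    · exact h1
    · exact absurd (h1 ▸ ha) (hmL b hb)
  have hdisj : Disjoint (P.image fun p => s(m p.1, m p.2))
      ((univ.filter fun v => deg T v = 1).image fun u => s(u, m u)) := by
    rw [Finset.disjoint_left]
    simp only [Finset.mem_image, Finset.mem_filter, Finset.mem_univ, true_and, not_exists, not_and]
    rintro _ ⟨p, hp, rfl⟩ u hu h
    obtain ⟨-, -, hp1, hp2, -⟩ := hP p hp
    rcases Sym2.eq_iff.1 h with ⟨h1, -⟩ | ⟨h1, -⟩
    · exact hmL _ hp1 (h1 ▸ hu)
    · exact hmL _ hp2 (h1 ▸ hu)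
  have hsub : (P.image fun p => s(m p.1, m p.2)) ∪
      ((univ.filter fun v => deg T v = 1).image fun u => s(u, m u)) ⊆ T.edgeFinset := by
    intro e he
    rw [SimpleGraph.mem_edgeFinset]
    rcases Finset.mem_union.1 he with he | he
    · obtain ⟨p, hp, rfl⟩ := Finset.mem_image.1 he
      exact (hP p hp).2.2.2.2
    · obtain ⟨u, -, rfl⟩ := Finset.mem_image.1 he
      exact hadj u
  have h4 := Finset.card_le_card hsub
  rw [Finset.card_union_of_disjoint hdisj, h1, h2] at h4
  have h5 := hT.card_edgeFinset
  omega

theorem nonempty_iso_wideSpider (hT : T.IsTree) {k a b : ℕ} (hk : 6 ≤ k)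
    (ha : a = (k - 1) / 2) (hb : b = k / 2) (hV : Fintype.card V = 2 * k)
    {M₀ : Finset (Sym2 V)} (hM₀ : M₀ ∈ matchings T) (hcov : ∀ v, v ∈ cov M₀)
    {f : V → ℤ} (hf1 : ∀ v, f v = 1 ∨ f v = -1) (hf : ∀ v w, T.Adj v w → f v + f w = 0)
    {P : Finset (V × V)} (hP : ∀ p ∈ P, f p.1 = 1 ∧ f p.2 = -1 ∧ deg T p.1 = 1 ∧ deg T p.2 = 1 ∧
      ∃ M ∈ matchings T, missed M = {p.1, p.2}) (hcard : (k - 1) ^ 2 / 4 ≤ P.card) :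
    Nonempty (T ≃g wideSpider a b) := by
  choose m hmM using fun v => mem_cov.1 (hcov v)
  have hadj : ∀ v, T.Adj v (m v) := fun v => adj_of_mem hM₀ (hmM v)
  have hm : ∀ v, m (m v) = v := fun v =>
    eq_of_mem hM₀ (hmM (m v)) (by rw [Sym2.eq_swap]; exact hmM v)
  have hinj : Function.Injective m := Function.LeftInverse.injective hm
  have hfm : ∀ v, f (m v) = - f v := fun v => by
    have := hf _ _ (hadj v)
    omega
  have hmL : ∀ u, deg T u = 1 → deg T (m u) ≠ 1 := fun u hu h => by
    have := three_le_deg_add_deg hT (by rw [Nat.card_eq_fintype_card]; omega) (hadj u)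
    omega
  set L := univ.filter fun v => deg T v = 1 with hL
  set L₁ := univ.filter fun v => deg T v = 1 ∧ f v = 1 with hL₁
  set L₂ := univ.filter fun v => deg T v = 1 ∧ f v = -1 with hL₂
  have hLu : L₁ ∪ L₂ = L := by
    ext v
    simp only [hL, hL₁, hL₂, Finset.mem_union, Finset.mem_filter, Finset.mem_univ, true_and]
    have := hf1 v
    tauto
  have hd : Disjoint L₁ L₂ := by
    rw [Finset.disjoint_left]
    simp only [hL₁, hL₂, Finset.mem_filter, Finset.mem_univ, true_and]
    rintro v ⟨-, h⟩ ⟨-, h'⟩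
    omega
  have hLcard : L₁.card + L₂.card = L.card := by
    rw [← hLu, Finset.card_union_of_disjoint hd]
  have hsub : P ⊆ L₁ ×ˢ L₂ := by
    intro p hp
    obtain ⟨h1, h2, h3, h4, -⟩ := hP p hp
    simp [hL₁, hL₂, h1, h2, h3, h4]
  have hPle := Finset.card_le_card hsub
  rw [Finset.card_product] at hPle
  have hprod := mul_le_sq_div_four L₁.card L₂.card
  rw [hLcard] at hprod
  have hdm : Disjoint L (L.image m) := by
    rw [Finset.disjoint_left]
    simp only [hL, Finset.mem_filter, Finset.mem_univ, true_and, Finset.mem_image, not_exists,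
      not_and]
    rintro _ h u hu rfl
    exact hmL u hu h
  have hRcard : (univ.filter fun v => deg T v ≠ 1 ∧ deg T (m v) ≠ 1).card + 2 * L.card = 2 * k := by
    have h1 : (univ.filter fun v => deg T v ≠ 1 ∧ deg T (m v) ≠ 1) = (L ∪ L.image m)ᶜ := by
      ext v
      simp only [hL, Finset.mem_filter, Finset.mem_univ, true_and, Finset.mem_compl,
        Finset.mem_union, Finset.mem_image, not_or, not_exists, not_and]
      refine and_congr_right fun _ => ⟨?_, ?_⟩
      · rintro h u hu rfl
        rw [hm] at h
        exact h hu
      · exact fun h h' => h (m v) h' (hm v)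
    have h2 := Finset.card_add_card_compl (L ∪ L.image m)
    rw [h1]
    rw [Finset.card_union_of_disjoint hdm, Finset.card_image_of_injective _ hinj] at h2
    omega
  set R := univ.filter fun v => deg T v ≠ 1 ∧ deg T (m v) ≠ 1 with hR
  have hge : k - 1 ≤ L.card := by
    by_contra hlt
    have h1 : L.card ^ 2 / 4 ≤ (k - 2) ^ 2 / 4 := sq_div_four_mono (by omega)
    have h2 : (k - 2) ^ 2 / 4 < (k - 1) ^ 2 / 4 := sq_div_four_strictMono (by omega) (by omega)
    omega
  rcases (show L.card = k ∨ L.card = k - 1 by omega) with hLk | hLk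
  · exfalso
    have hR0 : R = ∅ := by rw [← Finset.card_eq_zero]; omega
    have h1 := card_pairs_add_card_leaves_lt hT (by omega) hm hadj (f := f) (P := P) (by
      intro p hp
      obtain ⟨h1, h2, h3, h4, M, hM, hms⟩ := hP p hp
      refine ⟨h1, h2, h3, h4, ?_⟩
      rcases adj_partner_of_missed_pair hT (by omega) hm hadj h3 h4 hM hms with h | ⟨z, -, hz⟩
      · exact h
      · have : z ∈ R := by simpa [hR] using hz
        simp [hR0] at this)
    rw [← hL] at h1
    have h2 : k ≤ (k - 1) ^ 2 / 4 := by
      rw [Nat.le_div_iff_mul_le (by norm_num)]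
      obtain ⟨d, rfl⟩ := Nat.exists_eq_add_of_le hk
      rw [show 6 + d - 1 = d + 5 by omega]
      nlinarith
    omega
  rw [hLk] at hprod
  have hmul : L₁.card * L₂.card = (k - 1) ^ 2 / 4 := by omega
  have hPeq : P = L₁ ×ˢ L₂ := Finset.eq_of_subset_of_card_le hsub (by
    rw [Finset.card_product]; omega)
  obtain ⟨x, hxR, hfx⟩ : ∃ x ∈ R, f x = 1 := by
    obtain ⟨x, hx⟩ : R.Nonempty := by rw [← Finset.card_pos]; omega
    rcases hf1 x with h | h
    · exact ⟨x, hx, h⟩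
    · refine ⟨m x, ?_, by rw [hfm, h]; rfl⟩
      simp only [hR, Finset.mem_filter, Finset.mem_univ, true_and, hm] at hx ⊢
      exact hx.symm
  have hxdeg : deg T x ≠ 1 ∧ deg T (m x) ≠ 1 := by simpa [hR] using hxR
  have hReq : ∀ z, deg T z ≠ 1 ∧ deg T (m z) ≠ 1 → z = x ∨ z = m x := by
    have : {x, m x} = R := by
      refine Finset.eq_of_subset_of_card_le ?_ ?_
      · intro z hz
        rcases Finset.mem_insert.1 hz with rfl | hz
        · exact hxR
        · rw [Finset.mem_singleton.1 hz]
          simp only [hR, Finset.mem_filter, Finset.mem_univ, true_and, hm]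
          exact hxdeg.symm
      · rw [Finset.card_pair (hadj x).ne]
        omega
    intro z hz
    have hzR : z ∈ R := by simpa [hR] using hz
    rw [← this] at hzR
    simpa using hzR
  have hjoin : ∀ u ∈ L₁, ∀ v ∈ L₂, T.Adj (m u) (m v) ∨ (T.Adj (m u) x ∧ T.Adj (m x) (m v)) := by
    intro u hu v hv
    have hp : (u, v) ∈ P := by rw [hPeq]; exact Finset.mem_product.2 ⟨hu, hv⟩
    obtain ⟨h1, h2, h3, h4, M, hM, hms⟩ := hP _ hp
    simp only at h1 h2 h3 h4 hms
    rcases adj_partner_of_missed_pair hT (by omega) hm hadj h3 h4 hM hms with h | ⟨z, hz, hzR⟩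
    · exact Or.inl h
    rcases adj_partner_of_missed_pair hT (by omega) hm hadj h4 h3 hM
      (by rw [hms, Finset.pair_comm]) with h | ⟨w, hw, hwR⟩
    · exact Or.inl h.symm
    right
    have e1 := hf _ _ hz
    have e2 := hf _ _ hw
    have e3 := hfm u
    have e4 := hfm v
    have e5 := hfm x
    constructor
    · rcases hReq z hzR with rfl | rfl
      · exact hz
      · omega
    · rcases hReq w hwR with rfl | rfl
      · omega
      · exact hw.symm
  have hbal := balanced_of_mul_eq hmul (by omega)
  have hnotL : ∀ v, deg T v ≠ 1 → v ∉ L := fun v h => by simpa [hL] using h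
  have hnotLm : ∀ v, deg T (m v) ≠ 1 → ∀ L' ⊆ L, v ∉ L'.image m := by
    intro v h L' hL' hv
    obtain ⟨u, hu, rfl⟩ := Finset.mem_image.1 hv
    rw [hm] at h
    exact hnotL u h (hL' hu)
  have hs1 : L₁ ⊆ L := hLu ▸ Finset.subset_union_left
  have hs2 : L₂ ⊆ L := hLu ▸ Finset.subset_union_right
  have hc1 : 2 ≤ (L₁.image m).card := by rw [Finset.card_image_of_injective _ hinj]; omega
  have hc2 : 2 ≤ (L₂.image m).card := by rw [Finset.card_image_of_injective _ hinj]; omega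
  have hx₁ : ∀ u ∈ L₁, T.Adj x (m u) := by
    intro u hu
    refine (adj_of_joined hT (hadj x) hc1 hc2 (hnotLm _ (by rw [hm]; exact hxdeg.1) _ hs1)
      (hnotLm _ hxdeg.2 _ hs2) ?_ (Finset.mem_image_of_mem m hu)).symm
    simp only [Finset.mem_image]
    rintro _ ⟨u, hu, rfl⟩ _ ⟨v, hv, rfl⟩
    exact hjoin u hu v hv
  have hx₂ : ∀ u ∈ L₂, T.Adj (m x) (m u) := by
    intro u hu
    refine (adj_of_joined hT (hadj x).symm hc2 hc1 (hnotLm _ hxdeg.2 _ hs2)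
      (hnotLm _ (by rw [hm]; exact hxdeg.1) _ hs1) ?_ (Finset.mem_image_of_mem m hu)).symm
    simp only [Finset.mem_image]
    rintro _ ⟨v, hv, rfl⟩ _ ⟨u, hu, rfl⟩
    rcases hjoin u hu v hv with h | ⟨h, h'⟩
    · exact Or.inl h.symm
    · exact Or.inr ⟨h'.symm, h.symm⟩
  have hmL' : ∀ u ∈ L, m u ∉ L := fun u hu => hnotL _ (hmL u (by simpa [hL] using hu))
  rcases hbal with ⟨h1, h2⟩ | ⟨h1, h2⟩
  · refine nonempty_iso_wideSpider_of_adj hT (by omega) hm hadj (x := x) (L₁ := L₁) (L₂ := L₂)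
      (by omega) (by omega) hd ?_ ?_ ?_ hx₁ hx₂ <;> rw [hLu]
    · exact hmL'
    · exact hnotL _ hxdeg.1
    · exact hnotL _ hxdeg.2
  · refine nonempty_iso_wideSpider_of_adj hT (by omega) hm hadj (x := m x) (L₁ := L₂) (L₂ := L₁)
      (by omega) (by omega) hd.symm ?_ ?_ ?_ hx₂ (by simpa only [hm] using hx₁) <;>
      rw [Finset.union_comm, hLu]
    · exact hmL'
    · exact hnotL _ hxdeg.2
    · rw [hm]; exact hnotL _ hxdeg.1

theorem phi1_lt_wideSpider (hT : T.IsTree) {k a b : ℕ} (hk : 6 ≤ k)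
    (ha : a = (k - 1) / 2) (hb : b = k / 2) (hV : Fintype.card V = 2 * k)
    (hiso : IsEmpty (T ≃g wideSpider a b)) {c : ℝ} (hc : ((2 ^ (2 * k) : ℕ) : ℝ) + 1 ≤ c) :
    Z (phi1 c) T < c ^ (4 * k - 2) + a * b * c ^ (4 * k - 4) := by
  have hc1 : 1 ≤ c := by have := Nat.cast_nonneg (α := ℝ) (2 ^ (2 * k)); linarith
  have hc0 : 0 ≤ c := by linarith
  have hab : a * b = (k - 1) ^ 2 / 4 := by
    rw [sq_div_four, ha, hb, show k - 1 + 1 = k by omega]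
  have hab1 : 1 ≤ a * b := Nat.mul_pos (by omega) (by omega)
  have hN : (matchF T).card ≤ 2 ^ (2 * k) := hV ▸ card_matchF_le hT
  rw [Z_phi1]
  by_cases hperf : ∃ M ∈ matchings T, missed M = ∅
  · obtain ⟨M₀, hM₀, hms₀⟩ := hperf
    have hcov : ∀ v, v ∈ cov M₀ := fun v => by
      by_contra h
      rw [← mem_missed, hms₀] at h
      simp at h
    have hcard : ∀ M ∈ (matchF T).erase M₀, 2 ≤ (missed M).card := by
      intro M hM
      rw [Finset.mem_erase, mem_matchF] at hM
      have h1 := card_missed hM.2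
      by_contra hlt
      exact hM.1 (eq_of_missed_eq hT hM.2 hM₀ (by rw [hms₀, ← Finset.card_eq_zero]; omega))
    set t := ((matchF T).erase M₀).filter fun M => ∑ v ∈ missed M, deg T v = 2 with ht
    have htk : t.card ≤ a * b - 1 := by
      by_contra hlt
      obtain ⟨f, hf1, hf⟩ := exists_sign hT
      have hprop : ∀ M ∈ t, ∃ p : V × V, f p.1 = 1 ∧ f p.2 = -1 ∧ deg T p.1 = 1 ∧ deg T p.2 = 1 ∧
          missed M = {p.1, p.2} := by
        intro M hM
        rw [ht, Finset.mem_filter] at hM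
        obtain ⟨hM, h2⟩ := hM
        have h1 := hcard M hM
        have h3 := card_missed_le_sum_deg (M := M) hT (by omega)
        have hd : ∀ v ∈ missed M, deg T v = 1 := fun v hv =>
          deg_eq_one_of_sum_missed hT (by omega) (by omega) (mem_missed.1 hv)
        obtain ⟨u, v, huv, hms⟩ := Finset.card_eq_two.1 (show (missed M).card = 2 by omega)
        have hs := sum_missed_sign hf (mem_matchF.1 (Finset.mem_of_mem_erase hM))
        rw [← sum_missed_sign hf hM₀, hms₀, hms, Finset.sum_pair huv, Finset.sum_empty] at hs
        rw [hms] at hd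
        rcases hf1 u with h | h
        · exact ⟨(u, v), h, by simp only; omega, hd u (by simp), hd v (by simp), hms⟩
        · exact ⟨(v, u), by simp only; omega, h, hd v (by simp), hd u (by simp), by
            rw [hms, Finset.pair_comm]⟩
      have : Nonempty V := hT.connected.nonempty
      choose! p hp using hprop
      have hmem : ∀ M ∈ t, M ∈ matchings T := fun M hM =>
        mem_matchF.1 (Finset.mem_of_mem_erase (Finset.mem_filter.1 hM).1)
      refine hiso.false (nonempty_iso_wideSpider hT hk ha hb hV hM₀ hcov hf1 hf (P := t.image p)
        ?_ ?_).some
      · intro q hq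
        obtain ⟨M, hM, rfl⟩ := Finset.mem_image.1 hq
        obtain ⟨h1, h2, h3, h4, h5⟩ := hp M hM
        exact ⟨h1, h2, h3, h4, M, hmem M hM, h5⟩
      · rw [Finset.card_image_of_injOn]
        · omega
        · intro M hM M' hM' h
          refine eq_of_missed_eq hT (hmem M hM) (hmem M' hM') ?_
          rw [(hp M hM).2.2.2.2, (hp M' hM').2.2.2.2, h]
    have hrest := sum_lt_of_exceptional (s := (matchF T).erase M₀) (t := t)
      (Finset.filter_subset _ _) (f := fun M => c ^ (∑ v ∈ cov M, deg T v)) (m := a * b - 1)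
      (A := c ^ (4 * k - 4)) (B := c ^ (4 * k - 5))
      ((Finset.card_le_card (Finset.erase_subset _ _)).trans hN) htk
      (pow_nonneg hc0 _) (pow_nonneg hc0 _)
      (by
        intro M hM
        rw [ht, Finset.mem_filter] at hM
        have := sum_cov_deg_add hT M
        exact pow_le_pow_right₀ hc1 (by omega)) (by
        intro M hM hMt
        have h1 := sum_cov_deg_add hT M
        have h2 := hcard M hM
        have h3 := card_missed_le_sum_deg (M := M) hT (by omega)
        rw [ht, Finset.mem_filter, not_and] at hMt
        have := hMt hM
        exact pow_le_pow_right₀ hc1 (by omega)) (mul_pow_lt_pow_succ hc (4 * k - 5))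
    rw [← Finset.add_sum_erase _ _ (mem_matchF.2 hM₀)]
    have h0 : ∑ v ∈ cov M₀, deg T v = 4 * k - 2 := by
      have := sum_cov_deg_add hT M₀
      rw [hms₀, Finset.sum_empty] at this
      omega
    rw [h0]
    rw [show 4 * k - 5 + 1 = 4 * k - 4 by omega, Nat.cast_sub hab1] at hrest
    push_cast at hrest
    linarith
  · push Not at hperf
    have := sum_lt_of_forall (f := fun M => c ^ (∑ v ∈ cov M, deg T v)) hN
      (pow_nonneg hc0 (4 * k - 3)) (fun M hM => by
        have h1 := sum_cov_deg_add hT M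
        have h2 := Finset.card_pos.2 (hperf M (mem_matchF.1 hM))
        have h3 := card_missed_le_sum_deg (M := M) hT (by omega)
        exact pow_le_pow_right₀ hc1 (by omega)) (mul_pow_lt_pow_succ hc (4 * k - 3))
    rw [show 4 * k - 3 + 1 = 4 * k - 2 by omega] at this
    exact this.trans_le (le_add_of_nonneg_right (by positivity))

theorem le_Z_phi1_wideSpider {k a b : ℕ} (hab : a + b + 1 = k) {c : ℝ}
    (hc : 0 ≤ c) : c ^ (4 * k - 2) + a * b * c ^ (4 * k - 4) ≤ Z (phi1 c) (wideSpider a b) := by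
  rw [Z_phi1]
  have hE : {s(false, true)} ∈ matchings (SimpleGraph.starGraph false) := by
    refine ⟨by simp, ?_⟩
    intro e he f hf hne
    simp only [Finset.mem_singleton] at he hf
    exact absurd (he.trans hf.symm) hne
  have hcov₀ : ∀ x, x ∈ cov {s(false, true)} ∨ ∃ i ∈ (∅ : Finset (Fin a ⊕ Fin b)),
      x = legSide a b i := by
    rintro (_ | _)
    · exact Or.inl (mem_cov_left (w := true) (by simp))
    · exact Or.inl (mem_cov_right (v := false) (by simp))
  have hcov : ∀ p : Fin a × Fin b, ∀ x, x ∈ cov (∅ : Finset (Sym2 Bool)) ∨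
      ∃ i ∈ ({.inl p.1, .inr p.2} : Finset (Fin a ⊕ Fin b)),
        x = legSide a b i := by
    rintro p (_ | _)
    · exact Or.inr ⟨.inl p.1, by simp⟩
    · exact Or.inr ⟨.inr p.2, by simp⟩
  have hsum := sum_comp_le_sum_matchF (G := wideSpider a b)
    (F := fun M => c ^ (∑ v ∈ cov M, deg (wideSpider a b) v)) (fun M => pow_nonneg hc _)
    (g := fun o : Option (Fin a × Fin b) => o.elim (legEdges (legSide a b) {s(false, true)} ∅)
      fun p => legEdges (legSide a b) ∅ {.inl p.1, .inr p.2}) (by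
      rintro (_ | p) (_ | q) h
      · rfl
      · have := congrArg missed h
        simp [missed_legEdges (hcov _), missed_legEdges hcov₀] at this
        simpa using Finset.ext_iff.1 this (.inr (.inr (.inl q.1)))
      · have := congrArg missed h
        simp [missed_legEdges (hcov _), missed_legEdges hcov₀] at this
      · have := congrArg missed h
        simp only [Option.elim_some, missed_legEdges (hcov _)] at this
        have h1 : ∀ i, i ∈ ({.inl p.1, .inr p.2} : Finset (Fin a ⊕ Fin b)) ↔
            i ∈ ({.inl q.1, .inr q.2} : Finset (Fin a ⊕ Fin b)) := by
          intro i
          have := Finset.ext_iff.1 this (.inr (.inr i))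
          simpa using this
        have e1 := (h1 (.inl p.1)).1 (by simp)
        have e2 := (h1 (.inr p.2)).1 (by simp)
        simp at e1 e2
        rw [Prod.ext e1 e2]) (by
      rintro (_ | p)
      · exact legEdges_mem_matchings hE (by simp) (by simp)
      · refine legEdges_mem_matchings (empty_mem_matchings _) ?_ (by simp [cov])
        intro i hi j hj
        simp at hi hj
        rcases hi with rfl | rfl <;> rcases hj with rfl | rfl <;> simp)
  refine le_trans (le_of_eq ?_) hsum
  rw [Fintype.sum_option]
  have h0 := sum_cov_legEdges (r := false) (h := legSide a b) hcov₀
  change ∑ v ∈ cov _, deg (wideSpider a b) v + _ + 2 = _ at h0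
  simp only [Finset.card_empty, Fintype.card_bool, Fintype.card_sum, Fintype.card_fin] at h0
  simp only [Option.elim_none, Option.elim_some]
  congr 1
  · congr 1
    omega
  · rw [Finset.sum_congr rfl (g := fun _ => c ^ (4 * k - 4))]
    · simp
    · intro p _
      have h1 := sum_cov_legEdges (r := false) (h := legSide a b) (hcov p)
      change ∑ v ∈ cov _, deg (wideSpider a b) v + _ + 2 = _ at h1
      rw [Finset.card_pair (by simp)] at h1
      simp only [Fintype.card_bool, Fintype.card_sum, Fintype.card_fin] at h1
      congr 1
      omega

end PhiOneEven

theorem pendantEdges_doubleBroom {a b : ℕ} (ha : 1 ≤ a) (hb : 1 ≤ b) :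
    pendantEdges (doubleBroom a b) = Set.range fun i : Fin a ⊕ Fin b =>
      s(.inl (Sum.elim (fun _ => false) (fun _ => true) i), .inr i) := by
  have hf := le_deg_doubleBroom_false a b
  have ht := le_deg_doubleBroom_true a b
  have hleaf : ∀ i : Fin a ⊕ Fin b, deg (doubleBroom a b) (.inr i) = 1 := by
    intro i
    have : (doubleBroom a b).neighborSet (.inr i) =
        {.inl (Sum.elim (fun _ => false) (fun _ => true) i)} := by
      ext w
      rcases i with i | i <;> rcases w with (_ | _) | (j | j) <;>
        simp [doubleBroom, SimpleGraph.fromRel_adj]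
    rw [deg, this, Set.ncard_singleton]
  ext e
  constructor
  · rintro ⟨he, x, ⟨y, rfl⟩, hd⟩
    rw [SimpleGraph.mem_edgeSet] at he
    rcases x with (_ | _) | i
    · omega
    · omega
    · refine ⟨i, ?_⟩
      have hadj : (doubleBroom a b).Adj (.inr i)
          (.inl (Sum.elim (fun _ => false) (fun _ => true) i)) := by
        rcases i with i | i <;> simp [doubleBroom, SimpleGraph.fromRel_adj]
      rw [eq_of_deg_eq_one (hleaf i) he hadj]
      exact Sym2.eq_swap
  · rintro ⟨i, rfl⟩
    refine ⟨?_, .inr i, by simp, hleaf i⟩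
    rcases i with i | i <;> simp [doubleBroom, SimpleGraph.fromRel_adj]

theorem nonempty_wideSpider_iso {a b : ℕ} (ha : 1 ≤ a) (hb : 1 ≤ b) :
    Nonempty (wideSpider a b ≃g subdivide (doubleBroom a b) (pendantEdges (doubleBroom a b))) := by
  refine nonempty_subdivide_iso_legGraph (ψ := id) Function.bijective_id ?_ ?_ ?_
    (pendantEdges_doubleBroom ha hb)
  · rintro (_ | _) (_ | _) <;> simp [doubleBroom, SimpleGraph.fromRel_adj]
  · rintro (_ | _) (i | i) <;> simp [doubleBroom, SimpleGraph.fromRel_adj]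
  · rintro (i | i) (j | j) <;> simp [doubleBroom, SimpleGraph.fromRel_adj]

theorem phi1_maximizer_even (n : ℕ) (hn : 12 ≤ n) (heven : Even n) : ∀ᶠ c : ℝ in Filter.atTop,
    IsUniqueMaximizer.{u, 0} (phi1 c) n (balancedWideSpider n) := by
  have hn2 : n = 2 * (n / 2) := by
    obtain ⟨k, rfl⟩ := heven
    omega
  filter_upwards [Filter.eventually_ge_atTop (((2 ^ (2 * (n / 2)) : ℕ) : ℝ) + 1)] with c hc
  have hc0 : 0 ≤ c := by have := Nat.cast_nonneg (α := ℝ) (2 ^ (2 * (n / 2))); linarith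
  obtain ⟨F⟩ := nonempty_wideSpider_iso (a := (n / 2 + 1) / 2 - 1) (b := (n / 2 + 1 + 1) / 2 - 1)
    (by omega) (by omega)
  refine IsUniqueMaximizer.of_iso (isUniqueMaximizer_of_lt (legGraph_isTree _ _)
    (by simp; omega) fun U _ T hT hU hiso => ?_) F
  exact (phi1_lt_wideSpider hT (k := n / 2) (by omega) (by omega) (by omega) (hU.trans hn2) hiso
    hc).trans_le (le_Z_phi1_wideSpider (by omega) hc0)

end WeightedHosoya

theorem mainTheorem9 (n : ℕ) (hn : 1 ≤ n) :
    ∃ C : ℝ, ∀ c : ℝ, C ≤ c →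
      (12 ≤ n → Even n →
        WeightedHosoya.IsUniqueMaximizer.{u, 0} (WeightedHosoya.phi1 c) n
          (WeightedHosoya.balancedWideSpider n)) ∧
      (7 ≤ n → Odd n →
        WeightedHosoya.IsUniqueMaximizer.{u, 0} (WeightedHosoya.phi1 c) n
          (WeightedHosoya.oddSpider n)) ∧
      (6 ≤ n →
        WeightedHosoya.IsUniqueMaximizer.{u, 0} (WeightedHosoya.phi2 c) n
          (WeightedHosoya.doubleBroom (n / 2 - 1) ((n + 1) / 2 - 1))) ∧
      WeightedHosoya.IsUniqueMaximizer.{u, 0} (WeightedHosoya.phi3 c) n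
        (SimpleGraph.pathGraph n) ∧
      WeightedHosoya.IsUniqueMaximizer.{u, 0} (WeightedHosoya.phi4 c) n
        (SimpleGraph.pathGraph n) := by
  rw [← Filter.eventually_atTop]
  simp only [Filter.eventually_and, Filter.eventually_imp_distrib_left]
  exact ⟨WeightedHosoya.phi1_maximizer_even n, WeightedHosoya.phi1_maximizer_odd n,
    WeightedHosoya.phi2_maximizer n, WeightedHosoya.phi3_maximizer n hn,
    WeightedHosoya.phi4_maximizer n hn⟩
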